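/- Let $X$ be a compact metric space with a Borel probability measure $\mu_0$, let $W:X\times X\to\,]-\infty,\infty]$ be symmetric and lower semicontinuous, and let $\beta_0<0$ be such that $$\sup_{x\in X}\int_X e^{-\beta_0 W(x,y)}\,d\mu_0(y)<\infty .$$ Let $H^{(N)}(x_1,\dots,x_N)=\frac1N\sum_{i\ne j}W(x_i,x_j)$ (sum over ordered pairs of distinct indices) be the mean field Hamiltonian on $X^N$, and put $Z_{N,\beta}=\int_{X^N}e^{-\beta H^{(N)}}\,d\mu_0^{\otimes N}$, $\mu^{(N)}_\beta=e^{-\beta H^{(N)}}\mu_0^{\otimes N}/Z_{N,\beta}$ and $\delta_N(x_1,\dots,x_N)=\frac1N\sum_{i=1}^N\delta_{x_i}\in\mathcal P(X)$, where the space $\mathcal P(X)$ of Borel probability measures has the weak topology. For $\mu\in\mathcal P(X)$ put $E(\mu)=\int_{X^2}W\,d\mu^{\otimes2}$ and let $D(\mu)\in[0,\infty]$ be the entropy of $\mu$ relative to $\mu_0$; the expression $\beta E(\mu)+D(\mu)$ is read as $+\infty$ when $D(\mu)=+\infty$, and $0\cdot\infty=0$. Then for every real $\beta>\beta_0$: $0<Z_{N,\beta}<\infty$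 for all $N\ge1$; the measures $(\delta_N)_*(e^{-\beta H^{(N)}}\mu_0^{\otimes N})$ on $\mathcal P(X)$ satisfy, as $N\to\infty$, a large deviation principle with speed $N$ and (lower semicontinuous) rate function $\beta E+D$; the number $\inf_{\mathcal P(X)}(\beta E+D)$ is finite; and the laws $(\delta_N)_*\mu^{(N)}_\beta$ of the empirical measure under the Gibbs measures satisfy a large deviation principle with speed $N$ and rate function $\beta E+D-\inf_{\mathcal P(X)}(\beta E+D)$. In particular (the 2D vortex model), if $K\subset\mathbb R^2$ is compact with positive Lebesgue measure, $\mu_0$ is the normalized Lebesgue measure on $K$ and $W(x,y)=-\log|x-y|$ (with $W=+\infty$ on the diagonal), then all these conclusions hold for every real $\beta>-2$. -/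

import Mathlib

open MeasureTheory Filter Topology
open scoped ENNReal

noncomputable section

namespace MeanField

/-- The integral of a function with values in `[-∞, ∞]`, as the difference of the integrals of its
positive and negative parts (only used for functions which are bounded from below). -/
def eintegral {Z : Type*} [MeasurableSpace Z] (f : Z → EReal) (ν : Measure Z) : EReal :=
  ((∫⁻ z, (f z).toENNReal ∂ν : ℝ≥0∞) : EReal) - ((∫⁻ z, (-(f z)).toENNReal ∂ν : ℝ≥0∞) : EReal)

/-- A sequence of Borel measures `Γ n` on `Y` satisfies a large deviation principle with speed
`r n` and rate function `I`: here `I : Y → ]-∞, ∞]` is lower semicontinuous, and the upper bound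
holds for closed sets and the lower bound for open sets (with `log 0 = -∞`). -/
structure LDP {Y : Type*} [TopologicalSpace Y] (Γ : ℕ → @Measure Y (borel Y)) (r : ℕ → ℝ)
    (I : Y → EReal) : Prop where
  lowerSemicontinuous : LowerSemicontinuous I
  ne_bot : ∀ y, I y ≠ ⊥
  upper : ∀ F : Set Y, IsClosed F →
    limsup (fun n => ENNReal.log (Γ n F) / ((r n : ℝ) : EReal)) atTop ≤ -(⨅ y ∈ F, I y)
  lower : ∀ G : Set Y, IsOpen G →
    -(⨅ y ∈ G, I y) ≤ liminf (fun n => ENNReal.log (Γ n G) / ((r n : ℝ) : EReal)) atTop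

section

variable {X : Type*}

/-- The mean field Hamiltonian `H(x₁, …, x_N) = (1/N) ∑_{i ≠ j} W(x_i, x_j)`, the sum being over
all ordered pairs of distinct indices. -/
def hamiltonian (W : X × X → EReal) (N : ℕ) (x : Fin N → X) : EReal :=
  (((N : ℝ)⁻¹ : ℝ) : EReal) *
    ∑ p ∈ Finset.univ.filter (fun p : Fin N × Fin N => p.1 ≠ p.2), W (x p.1, x p.2)

variable [MeasurableSpace X]

/-- The measure `e^{-β H} μ₀^{⊗ N}` on `X^N`. -/
def gibbsWeight (μ₀ : Measure X) (W : X × X → EReal) (β : ℝ) (N : ℕ) : Measure (Fin N → X) :=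
  (Measure.pi fun _ => μ₀).withDensity
    fun x => EReal.exp (((-β : ℝ) : EReal) * hamiltonian W N x)

/-- The partition function `Z_{N,β} = ∫ e^{-β H} dμ₀^{⊗ N}`. -/
def partition (μ₀ : Measure X) (W : X × X → EReal) (β : ℝ) (N : ℕ) : ℝ≥0∞ :=
  ∫⁻ x, EReal.exp (((-β : ℝ) : EReal) * hamiltonian W N x) ∂(Measure.pi fun _ : Fin N => μ₀)

/-- The Gibbs measure `e^{-β H} μ₀^{⊗ N} / Z_{N,β}` on `X^N`. -/
def gibbs (μ₀ : Measure X) (W : X × X → EReal) (β : ℝ) (N : ℕ) : Measure (Fin N → X) :=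
  (partition μ₀ W β N)⁻¹ • gibbsWeight μ₀ W β N

/-- The empirical measure `δ_N(x₁, …, x_N) = (1/N) ∑ δ_{x_i}`. -/
def empirical {N : ℕ} [NeZero N] (x : Fin N → X) : ProbabilityMeasure X :=
  ⟨(N : ℝ≥0∞)⁻¹ • ∑ i, Measure.dirac (x i), ⟨by
    simp only [Measure.smul_apply, Measure.coe_finsetSum, Finset.sum_apply, measure_univ,
      Finset.sum_const, Finset.card_univ, Fintype.card_fin, smul_eq_mul, nsmul_eq_mul, mul_one]
    exact ENNReal.inv_mul_cancel (by exact_mod_cast NeZero.ne N) (ENNReal.natCast_ne_top N)⟩⟩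

/-- The law of the empirical measure under a measure `P` on `X^N`, as a Borel measure on the space
`𝓟(X)` with its weak topology. -/
def empiricalLaw [TopologicalSpace X] [OpensMeasurableSpace X] {N : ℕ} [NeZero N]
    (P : Measure (Fin N → X)) :
    @Measure (ProbabilityMeasure X) (borel (ProbabilityMeasure X)) :=
  @Measure.map _ _ _ (borel (ProbabilityMeasure X)) empirical P

/-- The macroscopic energy `E(μ) = ∫ W dμ^{⊗ 2}`. -/
def energy (W : X × X → EReal) (μ : ProbabilityMeasure X) : EReal :=
  eintegral W ((μ : Measure X).prod (μ : Measure X))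

/-- The free energy functional `β E(μ) + D(μ)`, where `D` is the entropy relative to `μ₀`. It is
`+∞` where `D(μ) = +∞`; this is a convention only for `β < 0` and `E(μ) = +∞`. -/
def freeEnergy (μ₀ : Measure X) (W : X × X → EReal) (β : ℝ) (μ : ProbabilityMeasure X) : EReal :=
  open Classical in
  if InformationTheory.klDiv (μ : Measure X) μ₀ = ⊤ then ⊤
  else (β : EReal) * energy W μ + ((InformationTheory.klDiv (μ : Measure X) μ₀ : ℝ≥0∞) : EReal)

/-- At inverse temperature `β` the Gibbs measures of the mean field Hamiltonian are well defined,
and, as the number `N = n + 1` of particles tends to infinity, there is a large deviation principle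
with speed `N` both for the laws of the empirical measure under the measures `e^{-β H} μ₀^{⊗ N}`,
with rate function `β E + D`, and for those under the Gibbs measures, with rate function
`β E + D - inf (β E + D)`, where the infimum is a real number. -/
structure GibbsLDP [TopologicalSpace X] [OpensMeasurableSpace X] (μ₀ : Measure X)
    (W : X × X → EReal) (β : ℝ) : Prop where
  partition_ne_zero : ∀ n : ℕ, partition μ₀ W β (n + 1) ≠ 0
  partition_ne_top : ∀ n : ℕ, partition μ₀ W β (n + 1) ≠ ⊤
  ldp_weight : LDP (fun n => empiricalLaw (gibbsWeight μ₀ W β (n + 1))) (fun n => (n : ℝ) + 1)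
    (freeEnergy μ₀ W β)
  ldp_gibbs : ∃ c : ℝ, (⨅ μ, freeEnergy μ₀ W β μ) = (c : EReal) ∧
    LDP (fun n => empiricalLaw (gibbs μ₀ W β (n + 1))) (fun n => (n : ℝ) + 1)
      (fun μ => freeEnergy μ₀ W β μ - (c : EReal))

end

/-- The logarithmic interaction `W(x, y) = -log |x - y|`, equal to `+∞` on the diagonal. -/
def logInteraction {X : Type*} [MetricSpace X] (p : X × X) : EReal :=
  -ENNReal.log (edist p.1 p.2)

end MeanField

end

/-! Since the space of probability measures is compact, a large deviation principle with speed `N`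
reduces to exponential bounds on small neighbourhoods of single measures `μ`, with rates as close to
the rate function as desired. The same bounds force lower semicontinuity and, applied to the whole
space, give the growth of the normalizing constant.

The singular interaction enters through `lintegral_exp_realHamiltonian_le`. The Hamiltonian is the
mean over `i` of `∑_{j ≠ i} V(x_i, x_j)`, so Jensen's inequality bounds its exponential by a mean of
exponentials in which, once `x_i` is fixed, the other particles are independent. Hence `∫ e^H ≤
(sup_x ∫ e^{V(x,y)} dμ₀(y))^(N-1)`: a one-particle exponential moment controls the `N`-particle
moment of the same order.

Upper bound. Near `μ`, write `W = Φ + (W - Φ)` with `Φ` continuous and below `W`. Up to a bounded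
error the energy of `Φ` is `N` times a continuous function of the empirical measure, and a test
function `φ` from the Donsker-Varadhan formula produces the entropy. It remains to see that `W - Φ`
costs nothing on the exponential scale. For `β ≥ 0` its sign is favourable. For `β < 0` the
integrals `∫ e^{-β(W-Φ_k)(x,y) + φ(y)} dμ₀(y)` converge to `∫ e^φ dμ₀` for each `x`, but not
uniformly; `exists_lintegral_tilted_le` absorbs the small set of bad points into a bounded one-body
potential. Where the entropy is infinite and `β < 0`, Sanov's bound is combined with a Chebyshev
bound of order `-β₀ > -β`.

Lower bound. Only measures of finite entropy matter, and for them the duality between entropy and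
exponential moments makes `W` integrable. Changing the law of the particles to `μ^{⊗N}`, weak laws
of large numbers for the empirical measure, the energy and the log-density give the claim. The first
of these laws is itself the upper bound for zero interaction and reference measure `μ`.

For the logarithm, `e^{-β₀ W} = |x - y|^{β₀}`, which is integrable near a point of the plane when
`β₀ > -2`. -/

namespace MeanField

/-! ### Large deviations from local exponential bounds -/

section LocalBounds

variable {Y : Type*} [TopologicalSpace Y]

/-- Around every point `y`, the measures decay at every exponential rate smaller than `I y`. -/
def LocalUpperBound (Γ : ℕ → @Measure Y (borel Y)) (I : Y → EReal) : Prop :=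
  ∀ y, ∀ a : ℝ, (a : EReal) < I y → ∃ G, IsOpen G ∧ y ∈ G ∧ ∃ K : ℝ, 0 < K ∧
    ∀ᶠ n : ℕ in atTop, Γ n G ≤ ENNReal.ofReal (K * Real.exp (-a * ((n : ℝ) + 1)))

/-- Around every point `y`, the measures decay at most at every exponential rate larger
than `I y`. -/
def LocalLowerBound (Γ : ℕ → @Measure Y (borel Y)) (I : Y → EReal) : Prop :=
  ∀ y, ∀ a : ℝ, I y < (a : EReal) → ∀ G, IsOpen G → y ∈ G → ∃ k : ℝ, 0 < k ∧
    ∀ᶠ n : ℕ in atTop, ENNReal.ofReal (k * Real.exp (-a * ((n : ℝ) + 1))) ≤ Γ n G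

lemma log_ofReal_exp_div {K : ℝ} (hK : 0 < K) (a : ℝ) (n : ℕ) :
    ENNReal.log (ENNReal.ofReal (K * Real.exp (-a * ((n : ℝ) + 1)))) / (((n : ℝ) + 1 : ℝ) : EReal) =
      ((Real.log K / ((n : ℝ) + 1) - a : ℝ) : EReal) := by
  rw [ENNReal.log_ofReal_of_pos (by positivity), ← EReal.coe_div,
    Real.log_mul hK.ne' (Real.exp_pos _).ne', Real.log_exp]
  congr 1
  have : (n : ℝ) + 1 ≠ 0 := by positivity
  field_simp
  ring

lemma tendsto_log_div_sub (K a : ℝ) :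
    Tendsto (fun n : ℕ => ((Real.log K / ((n : ℝ) + 1) - a : ℝ) : EReal)) atTop
      (𝓝 (-(a : EReal))) := by
  have h : Tendsto (fun n : ℕ => Real.log K / ((n : ℝ) + 1) - a) atTop (𝓝 (0 - a)) := by
    refine Tendsto.sub_const ?_ a
    exact tendsto_const_nhds.div_atTop
      (tendsto_atTop_add_const_right _ _ tendsto_natCast_atTop_atTop)
  rw [zero_sub] at h
  rw [← EReal.coe_neg]
  exact (continuous_coe_real_ereal.tendsto _).comp h

lemma limsup_log_div_le {u : ℕ → ℝ≥0∞} {K a : ℝ} (hK : 0 < K)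
    (h : ∀ᶠ n : ℕ in atTop, u n ≤ ENNReal.ofReal (K * Real.exp (-a * ((n : ℝ) + 1)))) :
    limsup (fun n => ENNReal.log (u n) / (((n : ℝ) + 1 : ℝ) : EReal)) atTop ≤ -(a : EReal) := by
  rw [← (tendsto_log_div_sub K a).limsup_eq]
  refine limsup_le_limsup ?_
  filter_upwards [h] with n hn
  rw [← log_ofReal_exp_div hK]
  exact EReal.div_le_div_right_of_nonneg (by exact_mod_cast (by positivity : (0:ℝ) ≤ (n:ℝ) + 1))
    (ENNReal.log_le_log hn)

lemma le_liminf_log_div {u : ℕ → ℝ≥0∞} {K a : ℝ} (hK : 0 < K)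
    (h : ∀ᶠ n : ℕ in atTop, ENNReal.ofReal (K * Real.exp (-a * ((n : ℝ) + 1))) ≤ u n) :
    -(a : EReal) ≤ liminf (fun n => ENNReal.log (u n) / (((n : ℝ) + 1 : ℝ) : EReal)) atTop := by
  rw [← (tendsto_log_div_sub K a).liminf_eq]
  refine liminf_le_liminf ?_
  filter_upwards [h] with n hn
  rw [← log_ofReal_exp_div hK]
  exact EReal.div_le_div_right_of_nonneg (by exact_mod_cast (by positivity : (0:ℝ) ≤ (n:ℝ) + 1))
    (ENNReal.log_le_log hn)

lemma EReal_neg_le_of_forall {x y : EReal} (h : ∀ a : ℝ, (a : EReal) < x → y ≤ -(a : EReal)) :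
    y ≤ -x := by
  rw [EReal.le_neg]
  refine le_of_forall_lt fun c hc => ?_
  obtain ⟨a, hca, hax⟩ := EReal.lt_iff_exists_real_btwn.1 hc
  exact hca.trans_le (EReal.le_neg.1 (h a hax))

lemma EReal_neg_le_of_forall' {x y : EReal} (h : ∀ a : ℝ, x < (a : EReal) → -(a : EReal) ≤ y) :
    -x ≤ y := by
  rw [EReal.neg_le]
  refine le_of_forall_gt fun c hc => ?_
  obtain ⟨a, hxa, hac⟩ := EReal.lt_iff_exists_real_btwn.1 hc
  exact (EReal.neg_le.1 (h a hxa)).trans_lt hac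

/-- In a compact space, local exponential bounds from above on a closed set give a global one. -/
lemma LocalUpperBound.exists_of_isClosed [CompactSpace Y] {Γ : ℕ → @Measure Y (borel Y)}
    {I : Y → EReal} (h : LocalUpperBound Γ I) {F : Set Y} (hF : IsClosed F) {a : ℝ}
    (ha : ∀ y ∈ F, (a : EReal) < I y) :
    ∃ K : ℝ, 0 < K ∧ ∀ᶠ n : ℕ in atTop,
      Γ n F ≤ ENNReal.ofReal (K * Real.exp (-a * ((n : ℝ) + 1))) := by
  refine hF.isCompact.induction_on (p := fun s => ∃ K : ℝ, 0 < K ∧ ∀ᶠ n : ℕ in atTop,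
      Γ n s ≤ ENNReal.ofReal (K * Real.exp (-a * ((n : ℝ) + 1)))) ?_ ?_ ?_ ?_
  · exact ⟨1, one_pos, by simp⟩
  · rintro s t hst ⟨K, hK, h⟩
    exact ⟨K, hK, h.mono fun n hn => (measure_mono hst).trans hn⟩
  · rintro s t ⟨K, hK, hs⟩ ⟨L, hL, ht⟩
    refine ⟨K + L, add_pos hK hL, ?_⟩
    filter_upwards [hs, ht] with n h1 h2
    rw [add_mul, ENNReal.ofReal_add (by positivity) (by positivity)]
    exact (measure_union_le _ _).trans (add_le_add h1 h2)
  · intro y hy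
    obtain ⟨G, hG, hyG, hK⟩ := h y a (ha y hy)
    exact ⟨G, mem_nhdsWithin_of_mem_nhds (hG.mem_nhds hyG), hK⟩

/-- If the measures decay at rate `a` on a neighbourhood `G` of `y`, no point `z` of `G` can have `I
z < a`: the lower bound at `z`, applied to `G` itself, would contradict that decay. -/
lemma lowerSemicontinuous_of_localBounds {Γ : ℕ → @Measure Y (borel Y)} {I : Y → EReal}
    (hup : LocalUpperBound Γ I) (hlow : LocalLowerBound Γ I) : LowerSemicontinuous I := by
  intro y c hc
  obtain ⟨a, hca, hay⟩ := EReal.lt_iff_exists_real_btwn.1 hc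
  obtain ⟨G, hG, hyG, K, hK, hb⟩ := hup y a hay
  filter_upwards [hG.mem_nhds hyG] with z hz
  refine hca.trans_le ?_
  by_contra hlt
  obtain ⟨b, hzb, hba⟩ := EReal.lt_iff_exists_real_btwn.1 (not_le.1 hlt)
  obtain ⟨k, hk, hb'⟩ := hlow z b hzb G hG hz
  have h1 := (le_liminf_log_div hk hb').trans
    ((liminf_le_limsup).trans (limsup_log_div_le hK hb))
  rw [EReal.neg_le_neg_iff] at h1
  exact absurd hba (not_lt.2 h1)

theorem LDP.of_localBounds [CompactSpace Y] {Γ : ℕ → @Measure Y (borel Y)} {I : Y → EReal}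
    (hbot : ∀ y, I y ≠ ⊥) (hup : LocalUpperBound Γ I) (hlow : LocalLowerBound Γ I) :
    LDP Γ (fun n => (n : ℝ) + 1) I where
  lowerSemicontinuous := lowerSemicontinuous_of_localBounds hup hlow
  ne_bot := hbot
  upper F hF := by
    refine EReal_neg_le_of_forall fun a ha => ?_
    obtain ⟨K, hK, h⟩ := hup.exists_of_isClosed hF fun y hy => ha.trans_le (iInf₂_le y hy)
    exact limsup_log_div_le hK h
  lower G hG := by
    refine EReal_neg_le_of_forall' fun a ha => ?_
    simp only [iInf_lt_iff] at ha
    obtain ⟨y, hy, hya⟩ := ha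
    obtain ⟨k, hk, h⟩ := hlow y a hya G hG hy
    exact le_liminf_log_div hk h

lemma ofReal_inv_mul_le {u Z : ℝ≥0∞} {K k a b : ℝ} (hk : 0 < k) (t : ℝ)
    (hu : u ≤ ENNReal.ofReal (K * Real.exp (-a * t)))
    (hZ : ENNReal.ofReal (k * Real.exp (-b * t)) ≤ Z) :
    Z⁻¹ * u ≤ ENNReal.ofReal (K / k * Real.exp (-(a - b) * t)) := by
  calc Z⁻¹ * u ≤ (ENNReal.ofReal (k * Real.exp (-b * t)))⁻¹ *
        ENNReal.ofReal (K * Real.exp (-a * t)) := by gcongr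
    _ = ENNReal.ofReal (K / k * Real.exp (-(a - b) * t)) := by
      rw [← ENNReal.ofReal_inv_of_pos (by positivity), ← ENNReal.ofReal_mul (by positivity)]
      congr 1
      have : Real.exp (-(a - b) * t) = Real.exp (-a * t) / Real.exp (-b * t) := by
        rw [← Real.exp_sub]; ring_nf
      rw [this]
      field_simp

lemma le_ofReal_inv_mul {u Z : ℝ≥0∞} {K k a b : ℝ} (hK : 0 < K) (t : ℝ)
    (hu : ENNReal.ofReal (k * Real.exp (-a * t)) ≤ u)
    (hZ : Z ≤ ENNReal.ofReal (K * Real.exp (-b * t))) :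
    ENNReal.ofReal (k / K * Real.exp (-(a - b) * t)) ≤ Z⁻¹ * u := by
  calc ENNReal.ofReal (k / K * Real.exp (-(a - b) * t))
    _ = (ENNReal.ofReal (K * Real.exp (-b * t)))⁻¹ * ENNReal.ofReal (k * Real.exp (-a * t)) := by
      rw [← ENNReal.ofReal_inv_of_pos (by positivity), ← ENNReal.ofReal_mul (by positivity)]
      congr 1
      have : Real.exp (-(a - b) * t) = Real.exp (-a * t) / Real.exp (-b * t) := by
        rw [← Real.exp_sub]; ring_nf
      rw [this]
      field_simp
    _ ≤ Z⁻¹ * u := by gcongr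

/-- Normalizing measures which satisfy local exponential bounds. -/
theorem LDP.of_localBounds_normalized [CompactSpace Y] {Γ : ℕ → @Measure Y (borel Y)}
    {I : Y → EReal} (hbot : ∀ y, I y ≠ ⊥) (hup : LocalUpperBound Γ I) (hlow : LocalLowerBound Γ I)
    {c : ℝ} (hc : ⨅ y, I y = (c : EReal)) :
    LDP (fun n => (Γ n Set.univ)⁻¹ • Γ n) (fun n => (n : ℝ) + 1) (fun y => I y - (c : EReal)) := by
  refine LDP.of_localBounds (fun y => ?_) ?_ ?_
  · induction hy : I y with
    | bot => exact absurd hy (hbot y)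
    | coe x => rw [← EReal.coe_sub]; exact EReal.coe_ne_bot _
    | top => simp
  · intro y a ha
    have ha' : ((a + c : ℝ) : EReal) < I y := by
      rw [EReal.coe_add]
      exact (EReal.lt_sub_iff_add_lt (.inl (EReal.coe_ne_bot c)) (.inl (EReal.coe_ne_top c))).1 ha
    -- The slack between `a + c` and `I y` is spent on the total mass: `a' - a > c`, so some
    -- near-minimizer bounds that mass from below at rate `a' - a`.
    obtain ⟨a', h1, h2⟩ := EReal.lt_iff_exists_real_btwn.1 ha'
    rw [EReal.coe_lt_coe_iff] at h1
    obtain ⟨G, hG, hyG, K, hK, hb⟩ := hup y a' h2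
    have : (⨅ y, I y) < ((a' - a : ℝ) : EReal) := by
      rw [hc, EReal.coe_lt_coe_iff]; linarith
    obtain ⟨z, hz⟩ := iInf_lt_iff.1 this
    obtain ⟨k, hk, hb'⟩ := hlow z _ hz Set.univ isOpen_univ trivial
    refine ⟨G, hG, hyG, K / k, by positivity, ?_⟩
    filter_upwards [hb, hb'] with n h3 h4
    rw [Measure.smul_apply, smul_eq_mul]
    simpa using ofReal_inv_mul_le hk _ h3 h4
  · intro y a ha G hG hyG
    have ha' : I y < ((a + c : ℝ) : EReal) := by
      rw [EReal.coe_add]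
      exact (EReal.sub_lt_iff (.inl (EReal.coe_ne_bot c)) (.inl (EReal.coe_ne_top c))).1 ha
    obtain ⟨a', h1, h2⟩ := EReal.lt_iff_exists_real_btwn.1 ha'
    rw [EReal.coe_lt_coe_iff] at h2
    obtain ⟨k, hk, hb⟩ := hlow y a' h1 G hG hyG
    obtain ⟨K, hK, hb'⟩ := hup.exists_of_isClosed isClosed_univ (a := a' - a) fun z _ => by
      refine lt_of_lt_of_le ?_ (iInf_le _ z)
      rw [hc, EReal.coe_lt_coe_iff]; linarith
    refine ⟨k / K, by positivity, ?_⟩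
    filter_upwards [hb, hb'] with n h3 h4
    rw [Measure.smul_apply, smul_eq_mul]
    simpa using le_ofReal_inv_mul hK _ h3 h4

end LocalBounds

end MeanField

/-! ### Mean field Hamiltonians of independent particles -/

namespace MeanField

/-- The mean field Hamiltonian of a real-valued interaction. -/
noncomputable def realHamiltonian {X : Type*} (V : X × X → ℝ) (N : ℕ) (x : Fin N → X) : ℝ :=
  (N : ℝ)⁻¹ * ∑ p ∈ Finset.univ.filter (fun p : Fin N × Fin N => p.1 ≠ p.2), V (x p.1, x p.2)

lemma realHamiltonian_mono {X : Type*} {V V' : X × X → ℝ} {N : ℕ} {x : Fin N → X}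
    (h : ∀ i j, i ≠ j → V (x i, x j) ≤ V' (x i, x j)) :
    realHamiltonian V N x ≤ realHamiltonian V' N x := by
  unfold realHamiltonian
  gcongr with p hp
  exact h _ _ (Finset.mem_filter.1 hp).2

lemma sum_offDiag_eq_sum_succAbove {n : ℕ} (f : Fin (n + 1) → Fin (n + 1) → ℝ) :
    ∑ p ∈ Finset.univ.filter (fun p : Fin (n + 1) × Fin (n + 1) => p.1 ≠ p.2), f p.1 p.2 =
      ∑ i, ∑ j, f i (i.succAbove j) := by
  have h := Finset.sum_filter_add_sum_filter_not Finset.univ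
    (fun p : Fin (n + 1) × Fin (n + 1) => p.1 ≠ p.2) (fun p => f p.1 p.2)
  have hd : ∑ p ∈ Finset.univ.filter (fun p : Fin (n + 1) × Fin (n + 1) => ¬ p.1 ≠ p.2),
      f p.1 p.2 = ∑ i, f i i := by
    refine Finset.sum_nbij' (fun p => p.1) (fun i => (i, i)) ?_ ?_ ?_ ?_ ?_ <;> simp
  have ht : ∑ p : Fin (n + 1) × Fin (n + 1), f p.1 p.2 =
      ∑ i, f i i + ∑ i, ∑ j, f i (i.succAbove j) := by
    rw [Fintype.sum_prod_type, ← Finset.sum_add_distrib]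
    exact Finset.sum_congr rfl fun i _ => Fin.sum_univ_succAbove _ i
  linarith

lemma exp_mean_le {n : ℕ} (a : Fin (n + 1) → ℝ) :
    Real.exp (((n + 1 : ℕ) : ℝ)⁻¹ * ∑ i, a i) ≤ ((n + 1 : ℕ) : ℝ)⁻¹ * ∑ i, Real.exp (a i) := by
  have h := convexOn_exp.map_sum_le (t := Finset.univ) (w := fun _ : Fin (n + 1) =>
    ((n + 1 : ℕ) : ℝ)⁻¹) (p := a) (fun _ _ => by positivity)
    (by simp; field_simp) (fun _ _ => trivial)
  simpa only [smul_eq_mul, ← Finset.mul_sum] using h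

section Product

variable {X : Type*} [MeasurableSpace X]

lemma lintegral_pi_prod (μ : Measure X) [IsProbabilityMeasure μ] {N : ℕ} {f : Fin N → X → ℝ≥0∞}
    (hf : ∀ i, Measurable (f i)) :
    ∫⁻ x, ∏ i, f i (x i) ∂(Measure.pi fun _ : Fin N => μ) = ∏ i, ∫⁻ y, f i y ∂μ := by
  rw [ProbabilityTheory.lintegral_prod_eq_prod_lintegral_of_indepFun Finset.univ
    (fun i (x : Fin N → X) => f i (x i))
    (ProbabilityTheory.iIndepFun_pi fun i => (hf i).aemeasurable)
    fun i => (hf i).comp (measurable_pi_apply i)]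
  refine Finset.prod_congr rfl fun i _ => ?_
  exact (measurePreserving_eval (fun _ : Fin N => μ) i).lintegral_comp (hf i)

lemma pi_withDensity (μ : Measure X) [IsProbabilityMeasure μ] {f : X → ℝ≥0∞} (hf : Measurable f)
    [IsProbabilityMeasure (μ.withDensity f)] (N : ℕ) :
    (Measure.pi fun _ : Fin N => μ.withDensity f) =
      (Measure.pi fun _ : Fin N => μ).withDensity fun x => ∏ i, f (x i) := by
  refine Measure.pi_eq fun s hs => ?_
  rw [withDensity_apply _ (MeasurableSet.univ_pi hs), ← lintegral_indicator (MeasurableSet.univ_pi hs)]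
  simp_rw [withDensity_apply _ (hs _), ← lintegral_indicator (hs _)]
  rw [← lintegral_pi_prod μ fun i => hf.indicator (hs i)]
  refine lintegral_congr fun x => ?_
  by_cases hx : x ∈ Set.univ.pi s
  · rw [Set.indicator_of_mem hx]
    exact Finset.prod_congr rfl fun i _ => (Set.indicator_of_mem (hx i trivial) f).symm
  · rw [Set.indicator_of_notMem hx]
    simp only [Set.mem_univ_pi, not_forall] at hx
    obtain ⟨i, hi⟩ := hx
    exact (Finset.prod_eq_zero (Finset.mem_univ i) (Set.indicator_of_notMem hi f)).symm

lemma measurePreserving_eval_pair (μ : Measure X) [IsProbabilityMeasure μ] {N : ℕ} {i j : Fin N}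
    (hij : i ≠ j) :
    MeasurePreserving (fun x : Fin N → X => (x i, x j)) (Measure.pi fun _ => μ) (μ.prod μ) := by
  refine ⟨by fun_prop, ?_⟩
  have hind : ProbabilityTheory.IndepFun (fun x : Fin N → X => x i) (fun x => x j)
      (Measure.pi fun _ => μ) :=
    (ProbabilityTheory.iIndepFun_pi (X := fun (_ : Fin N) (y : X) => y) (μ := fun _ => μ)
      fun i => aemeasurable_id).indepFun hij
  rw [(ProbabilityTheory.indepFun_iff_map_prod_eq_prod_map_map (measurable_pi_apply i).aemeasurable
    (measurable_pi_apply j).aemeasurable).1 hind]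
  congr 1
  · exact (measurePreserving_eval (fun _ : Fin N => μ) i).map_eq
  · exact (measurePreserving_eval (fun _ : Fin N => μ) j).map_eq

lemma measurable_realHamiltonian {V : X × X → ℝ} (hV : Measurable V) (N : ℕ) :
    Measurable (realHamiltonian V N) := by
  unfold realHamiltonian
  fun_prop

/-- Exponential moments of a mean field Hamiltonian are controlled by those of the interaction
with one particle. -/
theorem lintegral_exp_realHamiltonian_le (μ : Measure X) [IsProbabilityMeasure μ] {V : X × X → ℝ}
    (hV : Measurable V) {φ : X → ℝ} (hφ : Measurable φ) {A : ℝ} (hA : ∀ x, φ x ≤ A) {S : ℝ≥0∞}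
    (hS : ∀ x, ∫⁻ y, ENNReal.ofReal (Real.exp (V (x, y) + φ y)) ∂μ ≤ S) (n : ℕ) :
    ∫⁻ x, ENNReal.ofReal (Real.exp (realHamiltonian V (n + 1) x + ∑ i, φ (x i)))
      ∂(Measure.pi fun _ => μ) ≤ ENNReal.ofReal (Real.exp A) * S ^ n := by
  set P := Measure.pi fun _ : Fin (n + 1) => μ
  set e : Fin (n + 1) → (Fin (n + 1) → X) → ℝ := fun i x =>
    φ (x i) + ∑ j, (V (x i, x (i.succAbove j)) + φ (x (i.succAbove j)))
  have hpt : ∀ x : Fin (n + 1) → X,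
      ENNReal.ofReal (Real.exp (realHamiltonian V (n + 1) x + ∑ i, φ (x i))) ≤
        ((n + 1 : ℕ) : ℝ≥0∞)⁻¹ * ∑ i, ENNReal.ofReal (Real.exp (e i x)) := by
    intro x
    -- Each `e i` contains the full sum of `φ` over all particles, so averaging over `i` reproduces
    -- that sum exactly once.
    have hsum : realHamiltonian V (n + 1) x + ∑ i, φ (x i) =
        ((n + 1 : ℕ) : ℝ)⁻¹ * ∑ i, e i x := by
      have h1 : ∀ i, e i x = ∑ j, V (x i, x (i.succAbove j)) + ∑ j, φ (x j) := fun i => by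
        rw [Fin.sum_univ_succAbove _ i]
        simp only [e, Finset.sum_add_distrib]
        ring
      rw [realHamiltonian, sum_offDiag_eq_sum_succAbove (fun i j => V (x i, x j))]
      simp only [h1, Finset.sum_add_distrib, Finset.sum_const, Finset.card_univ, Fintype.card_fin,
        nsmul_eq_mul]
      rw [mul_add, inv_mul_cancel_left₀ (by positivity)]
    rw [hsum, ← ENNReal.ofReal_sum_of_nonneg (fun _ _ => (Real.exp_pos _).le),
      ← ENNReal.ofReal_natCast, ← ENNReal.ofReal_inv_of_pos (by positivity),
      ← ENNReal.ofReal_mul (by positivity)]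
    exact ENNReal.ofReal_le_ofReal (exp_mean_le _)
  have hmeas : ∀ i, Measurable fun x : Fin (n + 1) → X => ENNReal.ofReal (Real.exp (e i x)) := by
    intro i
    simp only [e]
    fun_prop
  have hone : ∀ i, ∫⁻ x, ENNReal.ofReal (Real.exp (e i x)) ∂P ≤
      ENNReal.ofReal (Real.exp A) * S ^ n := by
    intro i
    have hmp := measurePreserving_piFinSuccAbove (fun _ : Fin (n + 1) => μ) i
    set g : X × (Fin n → X) → ℝ≥0∞ := fun z => ENNReal.ofReal (Real.exp (φ z.1)) *
      ∏ j, ENNReal.ofReal (Real.exp (V (z.1, z.2 j) + φ (z.2 j))) with hg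
    have hgm : Measurable g := by
      simp only [hg]
      fun_prop
    have heq : ∀ x, ENNReal.ofReal (Real.exp (e i x)) =
        g (MeasurableEquiv.piFinSuccAbove (fun _ => X) i x) := by
      intro x
      simp only [e, hg, Real.exp_add, Real.exp_sum, MeasurableEquiv.piFinSuccAbove_apply,
        Fin.insertNthEquiv_symm_apply, Fin.removeNth]
      rw [ENNReal.ofReal_mul (Real.exp_pos _).le, ENNReal.ofReal_prod_of_nonneg
        (fun _ _ => by positivity)]
    simp_rw [heq]
    -- Given particle `i`, the integrand is a product over the `n` other particles. Each of them
    -- contributes a factor at most `S`; particle `i` only contributes `e^φ ≤ e^A`.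
    rw [hmp.lintegral_comp hgm, lintegral_prod _ hgm.aemeasurable]
    calc _ ≤ ∫⁻ _, ENNReal.ofReal (Real.exp A) * S ^ n ∂μ := by
          refine lintegral_mono fun y => ?_
          simp only [hg]
          rw [lintegral_const_mul _ (by fun_prop)]
          refine mul_le_mul' (ENNReal.ofReal_le_ofReal (Real.exp_le_exp.2 (hA y))) ?_
          rw [lintegral_pi_prod μ (f := fun _ z => ENNReal.ofReal (Real.exp (V (y, z) + φ z)))
            (fun _ => by fun_prop)]
          simpa using pow_le_pow_left' (hS y) n
      _ = _ := by simp
  calc _ ≤ ∫⁻ x, ((n + 1 : ℕ) : ℝ≥0∞)⁻¹ * ∑ i, ENNReal.ofReal (Real.exp (e i x)) ∂P :=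
        lintegral_mono hpt
    _ = ((n + 1 : ℕ) : ℝ≥0∞)⁻¹ * ∑ i, ∫⁻ x, ENNReal.ofReal (Real.exp (e i x)) ∂P := by
        rw [lintegral_const_mul _ (Finset.measurable_fun_sum _ fun i _ => hmeas i),
          lintegral_finsetSum _ fun i _ => hmeas i]
    _ ≤ ((n + 1 : ℕ) : ℝ≥0∞)⁻¹ * ∑ i : Fin (n + 1), ENNReal.ofReal (Real.exp A) * S ^ n := by
        gcongr with i
        exact hone i
    _ = _ := by
        rw [Finset.sum_const, Finset.card_univ, Fintype.card_fin, nsmul_eq_mul, ← mul_assoc,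
          ENNReal.inv_mul_cancel (by simp) (ENNReal.natCast_ne_top _), one_mul]

/-- The mean of the interaction over pairs of particles is bounded in mean by its integral. -/
lemma lintegral_abs_realHamiltonian_le (μ : Measure X) [IsProbabilityMeasure μ] {V : X × X → ℝ}
    (hV : Measurable V) (N : ℕ) :
    ∫⁻ x, ENNReal.ofReal |realHamiltonian V N x| ∂(Measure.pi fun _ => μ) ≤
      N * ∫⁻ p, ENNReal.ofReal |V p| ∂(μ.prod μ) := by
  rcases Nat.eq_zero_or_pos N with rfl | hN
  · simp [realHamiltonian]
  set F := Finset.univ.filter (fun p : Fin N × Fin N => p.1 ≠ p.2)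
  have hc : (F.card : ℝ≥0∞) ≤ N * N := by
    have : F.card ≤ N * N := (Finset.card_filter_le _ _).trans (by simp)
    exact_mod_cast this
  calc _ ≤ ∫⁻ x, (N : ℝ≥0∞)⁻¹ * ∑ p ∈ F, ENNReal.ofReal |V (x p.1, x p.2)|
        ∂(Measure.pi fun _ => μ) := by
        refine lintegral_mono fun x => ?_
        rw [← ENNReal.ofReal_sum_of_nonneg (fun _ _ => abs_nonneg _), ← ENNReal.ofReal_natCast,
          ← ENNReal.ofReal_inv_of_pos (by positivity), ← ENNReal.ofReal_mul (by positivity)]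
        refine ENNReal.ofReal_le_ofReal ?_
        rw [realHamiltonian, abs_mul, abs_of_nonneg (by positivity : (0 : ℝ) ≤ (N : ℝ)⁻¹)]
        gcongr
        exact Finset.abs_sum_le_sum_abs _ _
    _ = (N : ℝ≥0∞)⁻¹ * ∑ p ∈ F, ∫⁻ p, ENNReal.ofReal |V p| ∂(μ.prod μ) := by
        rw [lintegral_const_mul _ (by fun_prop), lintegral_finsetSum _ fun p _ => by fun_prop]
        congr 1
        refine Finset.sum_congr rfl fun p hp => ?_
        exact (measurePreserving_eval_pair μ (Finset.mem_filter.1 hp).2).lintegral_comp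
          (f := fun q => ENNReal.ofReal |V q|) (by fun_prop)
    _ ≤ (N : ℝ≥0∞)⁻¹ * (N * N * ∫⁻ p, ENNReal.ofReal |V p| ∂(μ.prod μ)) := by
        rw [Finset.sum_const, nsmul_eq_mul]
        gcongr
    _ = _ := by
        rw [mul_assoc, ← mul_assoc, ENNReal.inv_mul_cancel (by simp [hN.ne'])
          (ENNReal.natCast_ne_top _), one_mul]

end Product

end MeanField

/-! ### Continuous approximation from below -/

namespace MeanField

section Approximation

variable {Z : Type*} [MetricSpace Z]

lemma exists_real_le_of_lowerSemicontinuous [CompactSpace Z] {W : Z → EReal} (hW : LowerSemicontinuous W)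
    (hbot : ∀ p, W p ≠ ⊥) : ∃ c : ℝ, c ≤ 0 ∧ ∀ p, (c : EReal) ≤ W p := by
  rcases isEmpty_or_nonempty Z with hZ | hZ
  · exact ⟨0, le_rfl, fun p => hZ.elim p⟩
  obtain ⟨p₀, -, hp₀⟩ := (hW.lowerSemicontinuousOn Set.univ).exists_isMinOn Set.univ_nonempty
    isCompact_univ
  have hlt : ⊥ < min (W p₀) 0 := by
    simp [bot_lt_iff_ne_bot, hbot p₀]
  obtain ⟨c, -, hc⟩ := EReal.lt_iff_exists_real_btwn.1 hlt
  refine ⟨c, ?_, fun p => (hc.le.trans (min_le_left _ _)).trans (hp₀ (Set.mem_univ p))⟩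
  exact_mod_cast hc.le.trans (min_le_right _ _)

/-- The largest `L`-Lipschitz minorant of `m`. -/
noncomputable def lipschitzMinorant (m : Z → ℝ) (L : ℝ) (p : Z) : ℝ := ⨅ q, m q + L * dist p q

lemma bddBelow_lipschitzMinorant {m : Z → ℝ} {c L : ℝ} (hm : ∀ q, c ≤ m q) (hL : 0 ≤ L) (p : Z) :
    BddBelow (Set.range fun q => m q + L * dist p q) :=
  ⟨c, by rintro _ ⟨q, rfl⟩; have := hm q; dsimp only; nlinarith [dist_nonneg (x := p) (y := q)]⟩

lemma lipschitzMinorant_le {m : Z → ℝ} {c L : ℝ} (hm : ∀ q, c ≤ m q) (hL : 0 ≤ L) (p : Z) :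
    lipschitzMinorant m L p ≤ m p := by
  simpa [lipschitzMinorant] using ciInf_le (bddBelow_lipschitzMinorant hm hL p) p

lemma continuous_lipschitzMinorant {m : Z → ℝ} {c L : ℝ} (hm : ∀ q, c ≤ m q) (hL : 0 ≤ L) :
    Continuous (lipschitzMinorant m L) := by
  refine (LipschitzWith.of_le_add_mul L.toNNReal fun p p' => ?_).continuous
  have : Nonempty Z := ⟨p⟩
  rw [Real.coe_toNNReal _ hL, ← sub_le_iff_le_add]
  refine le_ciInf fun q => ?_
  rw [sub_le_iff_le_add]
  refine (ciInf_le (bddBelow_lipschitzMinorant hm hL p) q).trans ?_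
  have := dist_triangle p p' q
  nlinarith

/-- A lower semicontinuous function which does not take the value `-∞` is a pointwise limit from
below of continuous functions which are uniformly bounded from below. -/
theorem exists_continuous_tendsto_of_lowerSemicontinuous {W : Z → EReal}
    (hW : LowerSemicontinuous W) {c : ℝ} (hc : ∀ p, (c : EReal) ≤ W p) :
    ∃ Φ : ℕ → C(Z, ℝ), (∀ k p, min c 0 ≤ Φ k p) ∧ (∀ k p, (Φ k p : EReal) ≤ W p) ∧
      ∀ p, Tendsto (fun k => (Φ k p : EReal)) atTop (𝓝 (W p)) := by
  -- Truncation at height `k` makes the function real-valued. As `k ≥ 0`, it preserves the lower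
  -- bound `min c 0`, though possibly not `c`.
  set m : ℕ → Z → ℝ := fun k q => (min (W q) (k : ℝ)).toReal
  have hcoe : ∀ k q, (m k q : EReal) = min (W q) (k : ℝ) := fun k q => by
    refine EReal.coe_toReal ?_ ?_
    · exact ((min_le_right _ _).trans_lt (EReal.coe_lt_top _)).ne
    · exact (lt_min ((EReal.bot_lt_coe c).trans_le (hc q)) (EReal.bot_lt_coe _)).ne'
  have hm : ∀ k q, min c 0 ≤ m k q := fun k q => by
    rw [← EReal.coe_le_coe_iff, hcoe, le_min_iff]
    constructor
    · exact le_trans (by exact_mod_cast min_le_left _ _) (hc q)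
    · exact_mod_cast (min_le_right c 0).trans k.cast_nonneg
  refine ⟨fun k => ⟨lipschitzMinorant (m k) k, continuous_lipschitzMinorant (hm k) k.cast_nonneg⟩,
    fun k p => ?_, fun k p => ?_, fun p => ?_⟩
  · have : Nonempty Z := ⟨p⟩
    refine le_ciInf fun q => ?_
    have := hm k q
    have : 0 ≤ (k : ℝ) * dist p q := by positivity
    linarith
  · have h1 : ((lipschitzMinorant (m k) k p : ℝ) : EReal) ≤ m k p := by
      exact_mod_cast lipschitzMinorant_le (hm k) k.cast_nonneg p
    exact h1.trans ((hcoe k p).trans_le (min_le_left _ _))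
  · have hle : ∀ k : ℕ, ((lipschitzMinorant (m k) k p : ℝ) : EReal) ≤ W p := fun k => by
      have h1 : ((lipschitzMinorant (m k) k p : ℝ) : EReal) ≤ m k p := by
        exact_mod_cast lipschitzMinorant_le (hm k) k.cast_nonneg p
      exact h1.trans ((hcoe k p).trans_le (min_le_left _ _))
    have : Nonempty Z := ⟨p⟩
    refine tendsto_order.2 ⟨fun a ha => ?_, fun a ha => Eventually.of_forall fun k =>
      (hle k).trans_lt ha⟩
    obtain ⟨t, hat, htW⟩ := EReal.lt_iff_exists_real_btwn.1 ha
    obtain ⟨r, hr, hball⟩ := Metric.eventually_nhds_iff.1 (hW p t htW)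
    have h1 : ∀ᶠ k : ℕ in atTop, t ≤ (k : ℝ) := tendsto_natCast_atTop_atTop.eventually_ge_atTop t
    -- Within distance `r` of `p`, semicontinuity keeps `W` above `t`; farther away the penalty `k *
    -- r` alone lifts the lower bound `min c 0` above `t`.
    have h2 : ∀ᶠ k : ℕ in atTop, t - min c 0 ≤ (k : ℝ) * r :=
      (tendsto_natCast_atTop_atTop.atTop_mul_const hr).eventually_ge_atTop _
    filter_upwards [h1, h2] with k hk1 hk2
    refine hat.trans_le ?_
    change (t : EReal) ≤ ((lipschitzMinorant (m k) k p : ℝ) : EReal)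
    rw [EReal.coe_le_coe_iff]
    refine le_ciInf fun q => ?_
    rcases lt_or_ge (dist q p) r with hq | hq
    · have h3 : t ≤ m k q := by
        rw [← EReal.coe_le_coe_iff, hcoe, le_min_iff]
        exact ⟨(hball hq).le, by exact_mod_cast hk1⟩
      have : 0 ≤ (k : ℝ) * dist p q := by positivity
      linarith
    · rw [dist_comm] at hq
      have := hm k q
      have : (k : ℝ) * r ≤ k * dist p q := by gcongr
      linarith

end Approximation

/-! ### Relative entropy and its variational formula -/

section Entropy

open InformationTheory

/-- Young's inequality for the convex dual pair `u log u - u` and `e^v`, from `1 + s ≤ e^s` at `s =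
v - log u`. The constant `1` in `klFun` is to spare. -/
lemma mul_le_klFun_add_exp {u : ℝ} (hu : 0 ≤ u) (v : ℝ) : u * v ≤ klFun u + Real.exp v := by
  rcases hu.eq_or_lt with rfl | hu
  · simp [klFun_zero]; positivity
  · have h1 := Real.add_one_le_exp (v - Real.log u)
    rw [Real.exp_sub, Real.exp_log hu, le_div_iff₀ hu] at h1
    rw [klFun_apply]
    nlinarith

variable {X : Type*} [MeasurableSpace X]

/-- The entropy relative to `μ₀` and an exponential moment control the integral of a nonnegative
function. -/
lemma lintegral_le_klDiv_add {μ μ₀ : Measure X} [IsFiniteMeasure μ] [IsFiniteMeasure μ₀]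
    (hμ : μ ≪ μ₀) {v : X → ℝ} (hv : Measurable v) :
    ∫⁻ x, ENNReal.ofReal (v x) ∂μ ≤ klDiv μ μ₀ + ∫⁻ x, ENNReal.ofReal (Real.exp (v x)) ∂μ₀ := by
  rw [← lintegral_rnDeriv_mul hμ (by fun_prop), klDiv_eq_lintegral_klFun_of_ac hμ,
    ← lintegral_add_right _ (by fun_prop)]
  refine lintegral_mono_ae ?_
  filter_upwards [μ.rnDeriv_lt_top μ₀] with x hx
  have h0 : 0 ≤ (μ.rnDeriv μ₀ x).toReal := ENNReal.toReal_nonneg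
  rw [← ENNReal.ofReal_toReal hx.ne, ← ENNReal.ofReal_mul h0, ENNReal.toReal_ofReal h0,
    ← ENNReal.ofReal_add (klFun_nonneg h0) (Real.exp_pos _).le]
  exact ENNReal.ofReal_le_ofReal (mul_le_klFun_add_exp h0 _)

variable {μ μ₀ : Measure X} [IsProbabilityMeasure μ] [IsProbabilityMeasure μ₀]

/-- A large multiple of the indicator of a `μ₀`-null set charged by `μ` is invisible to `μ₀`. -/
lemma exists_bounded_lt_of_not_absolutelyContinuous (h : ¬ μ ≪ μ₀) (a : ℝ) :
    ∃ ψ : X → ℝ, Measurable ψ ∧ (∃ M, ∀ x, |ψ x| ≤ M) ∧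
      a < ∫ x, ψ x ∂μ - Real.log (∫ x, Real.exp (ψ x) ∂μ₀) := by
  have : ∃ s, MeasurableSet s ∧ μ₀ s = 0 ∧ μ s ≠ 0 := by
    by_contra! hc
    exact h (Measure.AbsolutelyContinuous.mk hc)
  obtain ⟨s, hs, h0, hμs⟩ := this
  have hpos : 0 < μ.real s := ENNReal.toReal_pos hμs (measure_ne_top _ _)
  set t : ℝ := (a + 1) / μ.real s
  refine ⟨s.indicator fun _ => t, measurable_const.indicator hs, ⟨|t|, fun x => ?_⟩, ?_⟩
  · by_cases hx : x ∈ s <;> simp [hx]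
  · have h1 : ∫ x, Real.exp (s.indicator (fun _ => t) x) ∂μ₀ = 1 := by
      rw [integral_congr_ae (g := fun _ => (1 : ℝ))]
      · simp
      · filter_upwards [compl_mem_ae_iff.2 h0] with x hx
        rw [Set.indicator_of_notMem hx, Real.exp_zero]
    rw [h1, integral_indicator_const _ hs, Real.log_one, smul_eq_mul, sub_zero]
    simp only [t]
    rw [mul_div_cancel₀ _ hpos.ne']
    linarith

/-- The optimal test function is the log-density. It is truncated to `[-n, n]`, and Fatou's lemma
recovers the entropy; this needs nonnegative integrands, hence the form `f ψ + 1 - f` modelled on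
`klFun`. -/
lemma exists_bounded_lt_of_absolutelyContinuous (h : μ ≪ μ₀) {a : ℝ} (ha : 0 ≤ a)
    (hD : ENNReal.ofReal a < klDiv μ μ₀) :
    ∃ ψ : X → ℝ, Measurable ψ ∧ (∃ M, ∀ x, |ψ x| ≤ M) ∧
      a < ∫ x, ψ x ∂μ - Real.log (∫ x, Real.exp (ψ x) ∂μ₀) := by
  obtain ⟨b', hab, hb⟩ := ENNReal.lt_iff_exists_nnreal_btwn.1 hD
  set b : ℝ := (b' : ℝ)
  have hab : a < b := by
    rw [ENNReal.ofReal_lt_iff_lt_toReal ha ENNReal.coe_ne_top] at hab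
    exact hab
  set f : X → ℝ := fun x => (μ.rnDeriv μ₀ x).toReal
  have hf : Measurable f := (μ.measurable_rnDeriv μ₀).ennreal_toReal
  have hf0 : ∀ x, 0 ≤ f x := fun x => ENNReal.toReal_nonneg
  have hfi : Integrable f μ₀ := Measure.integrable_toReal_rnDeriv
  have hf1 : ∫ x, f x ∂μ₀ = 1 := by
    rw [Measure.integral_toReal_rnDeriv h]; simp
  set ψ : ℕ → X → ℝ := fun n x => Real.log (max (Real.exp (-n)) (min (f x) (Real.exp n)))
  have hψm : ∀ n, Measurable (ψ n) := fun n => by simp only [ψ]; fun_prop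
  have hpos : ∀ n x, 0 < max (Real.exp (-(n : ℝ))) (min (f x) (Real.exp n)) := fun n x =>
    lt_max_of_lt_left (Real.exp_pos _)
  have hψM : ∀ n x, |ψ n x| ≤ n := fun n x => by
    rw [abs_le]
    constructor
    · rw [Real.le_log_iff_exp_le (hpos n x)]
      exact le_max_left _ _
    · rw [Real.log_le_iff_le_exp (hpos n x)]
      exact max_le (Real.exp_le_exp.2 (by linarith [(n.cast_nonneg : (0 : ℝ) ≤ n)]))
        (min_le_right _ _)
  have hψe : ∀ n x, Real.exp (ψ n x) ≤ f x + Real.exp (-n) := fun n x => by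
    simp only [ψ]
    rw [Real.exp_log (hpos n x)]
    refine max_le (by linarith [hf0 x]) ((min_le_left _ _).trans ?_)
    linarith [Real.exp_pos (-(n : ℝ))]
  -- Truncating the density from below adds at most `e^{-n}` to its integral `1`, and `log (1 + s) ≤
  -- s`.
  have hlog : ∀ n, Real.log (∫ x, Real.exp (ψ n x) ∂μ₀) ≤ Real.exp (-n) := fun n => by
    have hint : Integrable (fun x => Real.exp (ψ n x)) μ₀ :=
      (hfi.add (integrable_const (Real.exp (-(n : ℝ))))).mono' (by fun_prop)
        (ae_of_all _ fun x => by rw [Real.norm_eq_abs, Real.abs_exp]; exact hψe n x)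
    have h1 : ∫ x, Real.exp (ψ n x) ∂μ₀ ≤ 1 + Real.exp (-n) := by
      calc _ ≤ ∫ x, (f x + Real.exp (-n)) ∂μ₀ :=
            integral_mono hint (hfi.add (integrable_const _)) (hψe n)
        _ = _ := by rw [integral_add hfi (integrable_const _), hf1]; simp
    have h2 : 0 < ∫ x, Real.exp (ψ n x) ∂μ₀ := integral_exp_pos hint
    have := Real.log_le_sub_one_of_pos h2
    linarith
  set g : ℕ → X → ℝ := fun n x => f x * ψ n x + 1 - f x
  have hgm : ∀ n, Measurable (g n) := fun n => by simp only [g]; fun_prop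
  have hlim : ∀ x, Tendsto (fun n => ENNReal.ofReal (g n x)) atTop
      (𝓝 (ENNReal.ofReal (klFun (f x)))) := by
    intro x
    refine tendsto_const_nhds.congr' ?_
    rcases (hf0 x).eq_or_lt with hx | hx
    · refine Eventually.of_forall fun n => ?_
      simp [g, ← hx, klFun_zero]
    · have h1 : ∀ᶠ n : ℕ in atTop, |Real.log (f x)| ≤ n :=
        tendsto_natCast_atTop_atTop.eventually_ge_atTop _
      filter_upwards [h1] with n hn
      rw [abs_le] at hn
      have h2 : min (f x) (Real.exp n) = f x := min_eq_left ((Real.log_le_iff_le_exp hx).1 hn.2)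
      have h3 : max (Real.exp (-(n : ℝ))) (f x) = f x :=
        max_eq_right ((Real.le_log_iff_exp_le hx).1 hn.1)
      simp only [g, ψ, h2, h3, klFun_apply]
  have hfatou : klDiv μ μ₀ ≤ liminf (fun n => ∫⁻ x, ENNReal.ofReal (g n x) ∂μ₀) atTop := by
    rw [klDiv_eq_lintegral_klFun_of_ac h]
    calc _ = ∫⁻ x, liminf (fun n => ENNReal.ofReal (g n x)) atTop ∂μ₀ :=
          lintegral_congr fun x => (hlim x).liminf_eq.symm
      _ ≤ _ := lintegral_liminf_le fun n => (hgm n).ennreal_ofReal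
  have hev := eventually_lt_of_lt_liminf (hb.trans_le hfatou)
  have hexp : ∀ᶠ n : ℕ in atTop, Real.exp (-(n : ℝ)) < b - a := by
    have : Tendsto (fun n : ℕ => Real.exp (-(n : ℝ))) atTop (𝓝 0) :=
      Real.tendsto_exp_neg_atTop_nhds_zero.comp tendsto_natCast_atTop_atTop
    exact this.eventually_lt_const (by linarith)
  obtain ⟨n, hn1, hn2, hn3⟩ := (hev.and (hexp.and (eventually_ge_atTop 1))).exists
  refine ⟨ψ n, hψm n, ⟨n, hψM n⟩, ?_⟩
  have hg0 : ∀ x, 0 ≤ g n x := fun x => by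
    have hn1' : (1 : ℝ) ≤ n := by exact_mod_cast hn3
    -- If `f ≤ e^n`, truncation only raises the logarithm, so `g ≥ klFun f ≥ 0`. Otherwise `g = f (n
    -- - 1) + 1`, which is why `n ≥ 1` was demanded.
    rcases le_or_gt (f x) (Real.exp n) with hx | hx
    · rcases (hf0 x).eq_or_lt with h0 | h0
      · simp [g, ← h0]
      · have h4 : Real.log (f x) ≤ ψ n x := by
          simp only [ψ, min_eq_left hx]
          exact Real.log_le_log h0 (le_max_right _ _)
        have := klFun_nonneg h0.le
        rw [klFun_apply] at this
        simp only [g]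
        nlinarith
    · have h4 : ψ n x = n := by
        simp only [ψ, min_eq_right hx.le]
        rw [max_eq_right (Real.exp_le_exp.2 (by linarith)), Real.log_exp]
      simp only [g, h4]
      nlinarith [hf0 x]
  have hfψ : Integrable (fun x => f x * ψ n x) μ₀ :=
    (hfi.mul_const (n : ℝ)).mono' (by fun_prop) (ae_of_all _ fun x => by
      rw [norm_mul, Real.norm_eq_abs, Real.norm_eq_abs, abs_of_nonneg (hf0 x)]
      exact mul_le_mul_of_nonneg_left (hψM n x) (hf0 x))
  have hgi : Integrable (g n) μ₀ := (hfψ.add (integrable_const 1)).sub hfi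
  have hgint : ∫ x, g n x ∂μ₀ = ∫ x, ψ n x ∂μ := by
    have h1 : ∫ x, f x * ψ n x ∂μ₀ = ∫ x, ψ n x ∂μ := by
      simpa only [smul_eq_mul] using integral_rnDeriv_smul (f := ψ n) h
    simp only [g]
    have h2 : Integrable (fun x => f x * ψ n x + 1) μ₀ := hfψ.add (integrable_const 1)
    rw [integral_sub h2 hfi, integral_add hfψ (integrable_const 1), hf1, h1]
    simp
  rw [← ofReal_integral_eq_lintegral_ofReal hgi (ae_of_all _ hg0), hgint,
    ← ENNReal.ofReal_coe_nnreal] at hn1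
  have hn1 := (ENNReal.ofReal_lt_ofReal_iff_of_nonneg b'.2).1 hn1
  have := hlog n
  change b < _ at hn1
  linarith

lemma abs_exp_sub_exp_le {a b M : ℝ} (ha : a ≤ M) (hb : b ≤ M) :
    |Real.exp a - Real.exp b| ≤ Real.exp M * |a - b| := by
  wlog hab : b ≤ a generalizing a b
  · rw [abs_sub_comm, abs_sub_comm a b]
    exact this hb ha (le_of_not_ge hab)
  rw [abs_of_nonneg (sub_nonneg.2 (Real.exp_le_exp.2 hab)), abs_of_nonneg (sub_nonneg.2 hab)]
  have h1 := Real.add_one_le_exp (b - a)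
  have h2 : Real.exp b = Real.exp a * Real.exp (b - a) := by rw [← Real.exp_add]; ring_nf
  have h3 := Real.exp_le_exp.2 ha
  have h4 : Real.exp a - Real.exp b ≤ Real.exp a * (a - b) := by
    rw [h2]; nlinarith [Real.exp_pos a]
  exact h4.trans (mul_le_mul_of_nonneg_right h3 (sub_nonneg.2 hab))

variable [MetricSpace X] [CompactSpace X] [BorelSpace X]

/-- Continuous functions approximate `ψ` in `L¹(μ + μ₀)`, hence for both measures at once; a common
upper bound `M` makes the exponentials converge in `L¹(μ₀)` too. -/
lemma exists_continuousMap_lt_of_bounded {ψ : X → ℝ} (hψ : Measurable ψ) {M : ℝ}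
    (hM : ∀ x, |ψ x| ≤ M) {a : ℝ}
    (ha : a < ∫ x, ψ x ∂μ - Real.log (∫ x, Real.exp (ψ x) ∂μ₀)) :
    ∃ φ : C(X, ℝ), a < ∫ x, φ x ∂μ - Real.log (∫ x, Real.exp (φ x) ∂μ₀) := by
  have hψi : ∀ ν : Measure X, IsFiniteMeasure ν → Integrable ψ ν := fun ν _ =>
    (integrable_const M).mono' hψ.aestronglyMeasurable (ae_of_all _ hM)
  have hex : ∀ n : ℕ, ∃ φ : C(X, ℝ), (∀ x, φ x ≤ M) ∧
      ∫ x, |ψ x - φ x| ∂(μ + μ₀) ≤ 1 / ((n : ℝ) + 1) := by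
    intro n
    obtain ⟨g, hg, hgi⟩ := (hψi (μ + μ₀) inferInstance).exists_boundedContinuous_integral_sub_le
      (ε := 1 / ((n : ℝ) + 1)) (by positivity)
    -- Since `ψ ≤ M`, cutting off at `M` does not increase the distance to `ψ`.
    refine ⟨⟨fun x => min (g x) M, by fun_prop⟩, fun x => min_le_right _ _, le_trans ?_ hg⟩
    refine integral_mono_of_nonneg (ae_of_all _ fun _ => abs_nonneg _)
      ((hψi _ inferInstance).sub hgi).norm (ae_of_all _ fun x => ?_)
    change |ψ x - min (g x) M| ≤ |ψ x - g x|
    rcases le_total (g x) M with h | h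
    · rw [min_eq_left h]
    · rw [min_eq_right h]
      have := (abs_le.1 (hM x)).2
      rw [abs_of_nonpos (by linarith), abs_of_nonpos (by linarith)]
      linarith
  choose φ hφM hφ using hex
  have hφi : ∀ n, ∀ ν : Measure X, IsFiniteMeasure ν → Integrable (φ n) ν := fun n ν _ =>
    (φ n).continuous.integrable_of_hasCompactSupport (HasCompactSupport.of_compactSpace _)
  have hdi : ∀ n, ∀ ν : Measure X, IsFiniteMeasure ν → Integrable (fun x => |ψ x - φ n x|) ν :=
    fun n ν _ => ((hψi ν inferInstance).sub (hφi n ν inferInstance)).abs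
  have hadd : ∀ n, ∫ x, |ψ x - φ n x| ∂(μ + μ₀) =
      ∫ x, |ψ x - φ n x| ∂μ + ∫ x, |ψ x - φ n x| ∂μ₀ := fun n =>
    integral_add_measure (hdi n μ inferInstance) (hdi n μ₀ inferInstance)
  have hnn : ∀ n, ∀ ν : Measure X, 0 ≤ ∫ x, |ψ x - φ n x| ∂ν := fun n ν =>
    integral_nonneg fun _ => abs_nonneg _
  have h0 : Tendsto (fun n : ℕ => 1 / ((n : ℝ) + 1)) atTop (𝓝 0) := tendsto_one_div_add_atTop_nhds_zero_nat
  have ht1 : Tendsto (fun n => ∫ x, φ n x ∂μ) atTop (𝓝 (∫ x, ψ x ∂μ)) := by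
    rw [tendsto_iff_norm_sub_tendsto_zero]
    refine squeeze_zero (fun _ => norm_nonneg _) (fun n => ?_) h0
    rw [← integral_sub (hφi n μ inferInstance) (hψi μ inferInstance)]
    refine (norm_integral_le_integral_norm _).trans ?_
    simp only [Real.norm_eq_abs, abs_sub_comm (φ n _)]
    linarith [hφ n, hadd n, hnn n μ₀]
  have ht2 : Tendsto (fun n => ∫ x, Real.exp (φ n x) ∂μ₀) atTop
      (𝓝 (∫ x, Real.exp (ψ x) ∂μ₀)) := by
    rw [tendsto_iff_norm_sub_tendsto_zero]
    have h0' : Tendsto (fun n : ℕ => Real.exp M * (1 / ((n : ℝ) + 1))) atTop (𝓝 0) := by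
      simpa using h0.const_mul (Real.exp M)
    have hei : ∀ χ : X → ℝ, Measurable χ → (∀ x, χ x ≤ M) →
        Integrable (fun x => Real.exp (χ x)) μ₀ := fun χ hχ hχM =>
      (integrable_const (Real.exp M)).mono' (by fun_prop) (ae_of_all _ fun x => by
        rw [Real.norm_eq_abs, Real.abs_exp]; exact Real.exp_le_exp.2 (hχM x))
    refine squeeze_zero (fun _ => norm_nonneg _) (fun n => ?_) h0'
    rw [← integral_sub (hei _ (φ n).continuous.measurable (hφM n))
      (hei _ hψ fun x => (abs_le.1 (hM x)).2)]
    refine (norm_integral_le_integral_norm _).trans ?_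
    calc _ ≤ ∫ x, Real.exp M * |ψ x - φ n x| ∂μ₀ := by
          refine integral_mono_of_nonneg (ae_of_all _ fun _ => norm_nonneg _)
            ((hdi n μ₀ inferInstance).const_mul _) (ae_of_all _ fun x => ?_)
          change |_| ≤ Real.exp M * |ψ x - φ n x|
          rw [abs_sub_comm (ψ x)]
          exact abs_exp_sub_exp_le (hφM n x) (abs_le.1 (hM x)).2
      _ ≤ _ := by
          rw [integral_const_mul]
          gcongr
          linarith [hφ n, hadd n, hnn n μ]
  have hpos : 0 < ∫ x, Real.exp (ψ x) ∂μ₀ := by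
    refine integral_exp_pos ((integrable_const (Real.exp M)).mono' (by fun_prop)
      (ae_of_all _ fun x => ?_))
    rw [Real.norm_eq_abs, Real.abs_exp]
    exact Real.exp_le_exp.2 (abs_le.1 (hM x)).2
  have ht := ht1.sub (ht2.log hpos.ne')
  obtain ⟨n, hn⟩ := (ht.eventually_const_lt ha).exists
  exact ⟨φ n, hn⟩

/-- The entropy is at most the supremum in the variational formula of Donsker and Varadhan, over
continuous functions. -/
theorem exists_continuousMap_lt_of_lt_klDiv {a : ℝ} (ha : (a : EReal) < (klDiv μ μ₀ : ℝ≥0∞)) :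
    ∃ φ : C(X, ℝ), a < ∫ x, φ x ∂μ - Real.log (∫ x, Real.exp (φ x) ∂μ₀) := by
  rcases lt_or_ge a 0 with h0 | h0
  · exact ⟨0, by simpa using h0⟩
  have ha' : ENNReal.ofReal a < klDiv μ μ₀ := by
    rw [← EReal.coe_ennreal_lt_coe_ennreal_iff, EReal.coe_ennreal_ofReal, max_eq_left h0]
    exact ha
  have : ∃ ψ : X → ℝ, Measurable ψ ∧ (∃ M, ∀ x, |ψ x| ≤ M) ∧
      a < ∫ x, ψ x ∂μ - Real.log (∫ x, Real.exp (ψ x) ∂μ₀) := by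
    by_cases h : μ ≪ μ₀
    · exact exists_bounded_lt_of_absolutelyContinuous h h0 ha'
    · exact exists_bounded_lt_of_not_absolutelyContinuous h a
  obtain ⟨ψ, hψ, ⟨M, hM⟩, hlt⟩ := this
  exact exists_continuousMap_lt_of_bounded hψ hM hlt

end Entropy

end MeanField

/-! ### Empirical measures and the diagonal -/

namespace MeanField

lemma realHamiltonian_add {X : Type*} (V V' : X × X → ℝ) (N : ℕ) (x : Fin N → X) :
    realHamiltonian (fun p => V p + V' p) N x =
      realHamiltonian V N x + realHamiltonian V' N x := by
  simp only [realHamiltonian, Finset.sum_add_distrib, mul_add]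

lemma realHamiltonian_const_mul {X : Type*} (a : ℝ) (V : X × X → ℝ) (N : ℕ) (x : Fin N → X) :
    realHamiltonian (fun p => a * V p) N x = a * realHamiltonian V N x := by
  simp only [realHamiltonian, ← Finset.mul_sum]
  ring

lemma realHamiltonian_eq_sum_sub {X : Type*} (V : X × X → ℝ) (N : ℕ) (x : Fin N → X) :
    realHamiltonian V N x =
      (N : ℝ)⁻¹ * ∑ i, ∑ j, V (x i, x j) - (N : ℝ)⁻¹ * ∑ i, V (x i, x i) := by
  have h := Finset.sum_filter_add_sum_filter_not Finset.univ
    (fun p : Fin N × Fin N => p.1 ≠ p.2) (fun p => V (x p.1, x p.2))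
  have hd : ∑ p ∈ Finset.univ.filter (fun p : Fin N × Fin N => ¬ p.1 ≠ p.2),
      V (x p.1, x p.2) = ∑ i, V (x i, x i) := by
    refine Finset.sum_nbij' (fun p => p.1) (fun i => (i, i)) ?_ ?_ ?_ ?_ ?_ <;> simp +contextual
  rw [hd, Fintype.sum_prod_type] at h
  rw [realHamiltonian, ← h]
  ring

lemma exists_abs_le {X : Type*} [TopologicalSpace X] [CompactSpace X] (f : C(X, ℝ)) : ∃ M, ∀ x, |f x| ≤ M := by
  obtain ⟨M, hM⟩ := isCompact_univ.exists_bound_of_continuousOn (f := f) f.continuous.continuousOn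
  exact ⟨M, fun x => hM x trivial⟩

/-- Every particle occurs in `2n` ordered pairs, so the exact value is `2n/(n+1) ∑ u(x_i)`. -/
lemma realHamiltonian_one_body_le {X : Type*} {u : X → ℝ} (hu : ∀ x, 0 ≤ u x) {n : ℕ} (x : Fin (n + 1) → X) :
    realHamiltonian (fun p => u p.1 + u p.2) (n + 1) x ≤ ∑ i, 2 * u (x i) := by
  rw [realHamiltonian_eq_sum_sub]
  have h0 : (0 : ℝ) < (n : ℝ) + 1 := by positivity
  have h1 : ∑ i, ∑ j, (u (x i) + u (x j)) = ((n : ℝ) + 1) * ∑ i, 2 * u (x i) := by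
    simp only [Finset.sum_add_distrib, Finset.sum_const, Finset.card_univ, Fintype.card_fin,
      nsmul_eq_mul, ← Finset.mul_sum]
    push_cast
    ring
  rw [h1]
  push_cast
  rw [inv_mul_cancel_left₀ h0.ne']
  have : 0 ≤ ∑ i, (u (x i) + u (x i)) := Finset.sum_nonneg fun i _ => add_nonneg (hu _) (hu _)
  have : 0 ≤ ((n : ℝ) + 1)⁻¹ * ∑ i, (u (x i) + u (x i)) := by positivity
  linarith

section Empirical

variable {X : Type*} [MeasurableSpace X] {n : ℕ}

lemma coe_empirical (x : Fin (n + 1) → X) :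
    (empirical x : Measure X) = ((n + 1 : ℕ) : ℝ≥0∞)⁻¹ • ∑ i, Measure.dirac (x i) := rfl

lemma integral_empirical {φ : X → ℝ} (hφ : Measurable φ) (x : Fin (n + 1) → X) :
    ∫ y, φ y ∂(empirical x : Measure X) = ((n + 1 : ℕ) : ℝ)⁻¹ * ∑ i, φ (x i) := by
  rw [coe_empirical, integral_smul_measure, integral_finsetSum_measure fun i _ =>
    integrable_dirac' hφ.stronglyMeasurable (by simp)]
  simp only [integral_dirac' _ _ hφ.stronglyMeasurable, ENNReal.toReal_inv, ENNReal.toReal_natCast,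
    smul_eq_mul]

lemma integral_prod_empirical {V : X × X → ℝ} (hV : Measurable V) {M : ℝ} (hM : ∀ p, |V p| ≤ M)
    (x : Fin (n + 1) → X) :
    ∫ p, V p ∂((empirical x : Measure X).prod (empirical x : Measure X)) =
      ((n + 1 : ℕ) : ℝ)⁻¹ * (((n + 1 : ℕ) : ℝ)⁻¹ * ∑ i, ∑ j, V (x i, x j)) := by
  rw [integral_prod _ ((integrable_const M).mono' hV.aestronglyMeasurable (ae_of_all _ hM))]
  have h1 : ∀ y, ∫ z, V (y, z) ∂(empirical x : Measure X) =
      ((n + 1 : ℕ) : ℝ)⁻¹ * ∑ j, V (y, x j) := fun y =>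
    integral_empirical (φ := fun z => V (y, z)) (by fun_prop) x
  simp_rw [h1]
  rw [integral_empirical (by fun_prop), ← Finset.mul_sum]

/-- The two sides differ by the mean of the diagonal terms `V(x_i, x_i)`. This bounded error is
negligible at speed `N`, so a bounded interaction may be replaced by a functional of the empirical
measure. -/
lemma abs_realHamiltonian_sub_le {V : X × X → ℝ} (hV : Measurable V) {M : ℝ}
    (hM : ∀ p, |V p| ≤ M) (x : Fin (n + 1) → X) :
    |realHamiltonian V (n + 1) x - ((n : ℝ) + 1) *
      ∫ p, V p ∂((empirical x : Measure X).prod (empirical x : Measure X))| ≤ M := by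
  rw [integral_prod_empirical hV hM, realHamiltonian_eq_sum_sub]
  have h0 : (0 : ℝ) < (n : ℝ) + 1 := by positivity
  push_cast
  rw [mul_inv_cancel_left₀ h0.ne', sub_sub_cancel_left, abs_neg, abs_mul,
    abs_of_pos (inv_pos.2 h0), inv_mul_le_iff₀ h0]
  refine (Finset.abs_sum_le_sum_abs _ _).trans ((Finset.sum_le_sum fun i _ => hM _).trans ?_)
  simp

variable [MetricSpace X] [CompactSpace X] [BorelSpace X]

lemma continuous_integral_prod_self (Φ : C(X × X, ℝ)) :
    Continuous fun ν : ProbabilityMeasure X => ∫ p, Φ p ∂((ν : Measure X).prod (ν : Measure X)) := by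
  have h1 : Continuous fun ν : ProbabilityMeasure X => ν.prod ν :=
    ProbabilityMeasure.continuous_prod.comp (continuous_id.prodMk continuous_id)
  exact (ProbabilityMeasure.continuous_integral_continuousMap Φ).comp h1

lemma continuous_empirical : Continuous (empirical : (Fin (n + 1) → X) → ProbabilityMeasure X) := by
  rw [ProbabilityMeasure.continuous_iff_forall_continuousMap_continuous_integral]
  intro f
  simp_rw [integral_empirical f.continuous.measurable]
  fun_prop

lemma measurable_empirical :
    @Measurable _ _ _ (borel (ProbabilityMeasure X))
      (empirical : (Fin (n + 1) → X) → ProbabilityMeasure X) :=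
  measurable_generateFrom fun _ ht => (IsOpen.preimage continuous_empirical ht).measurableSet

lemma empiricalLaw_apply (P : Measure (Fin (n + 1) → X)) {s : Set (ProbabilityMeasure X)}
    (hs : MeasurableSet[borel (ProbabilityMeasure X)] s) :
    empiricalLaw P s = P (empirical ⁻¹' s) :=
  @Measure.map_apply _ _ _ (borel (ProbabilityMeasure X)) P _ measurable_empirical _ hs

lemma measurableSet_preimage_empirical {G : Set (ProbabilityMeasure X)} (hG : IsOpen G) :
    MeasurableSet ((empirical : (Fin (n + 1) → X) → ProbabilityMeasure X) ⁻¹' G) :=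
  (hG.preimage continuous_empirical).measurableSet

end Empirical

end MeanField

/-! ### Exponential estimates for tilted weights -/

namespace MeanField

variable {X : Type*} [MetricSpace X] [CompactSpace X] [MeasurableSpace X] [BorelSpace X]

/-- A real-valued interaction `w`, bounded from below by `c`, with a uniform exponential moment of
order `b₀`, which is approximated from below by continuous functions `Φ k` outside of null sets. -/
structure RealInteraction (μ₀ : Measure X) (w : X × X → ℝ) (Φ : ℕ → C(X × X, ℝ)) (b₀ c : ℝ)
    (C : ℝ≥0∞) : Prop where
  measurable : Measurable w
  le_interaction : ∀ p, c ≤ w p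
  le_approx : ∀ k p, c ≤ Φ k p
  approx_le : ∀ x, ∀ᵐ y ∂μ₀, ∀ k, Φ k (x, y) ≤ w (x, y)
  tendsto : ∀ x, ∀ᵐ y ∂μ₀, Tendsto (fun k => Φ k (x, y)) atTop (𝓝 (w (x, y)))
  pos : 0 < b₀
  exp_moment : ∀ x, ∫⁻ y, ENNReal.ofReal (Real.exp (b₀ * w (x, y))) ∂μ₀ ≤ C
  ne_top : C ≠ ⊤

/-- The measure `e^{-β H} μ₀^{⊗ N}` for a real-valued interaction. -/
noncomputable def realWeight (μ₀ : Measure X) (w : X × X → ℝ) (β : ℝ) (N : ℕ) :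
    Measure (Fin N → X) :=
  (Measure.pi fun _ => μ₀).withDensity
    fun x => ENNReal.ofReal (Real.exp (-β * realHamiltonian w N x))

section TiltedBound

variable {μ₀ : Measure X}

/-- Near `μ`, the Gibbs weight is controlled by the integral of an exponentially tilted weight in
which a continuous part `Φ` of the interaction has been replaced by its mean field value. -/
lemma exists_isOpen_realWeight_le {w : X × X → ℝ} {β : ℝ}
    (Φ : C(X × X, ℝ)) (φ : C(X, ℝ)) {A S : ℝ} (hS : 0 < S) (hA : 0 < A)
    (hbound : ∀ n : ℕ, ∫⁻ x, ENNReal.ofReal (Real.exp (realHamiltonian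
      (fun p => -β * (w p - Φ p)) (n + 1) x + ∑ i, φ (x i))) ∂(Measure.pi fun _ => μ₀) ≤
        ENNReal.ofReal (A * S ^ n)) (μ : ProbabilityMeasure X) {a : ℝ}
    (ha : a < β * ∫ p, Φ p ∂((μ : Measure X).prod (μ : Measure X)) +
      (∫ x, φ x ∂(μ : Measure X) - Real.log S)) :
    ∃ G : Set (ProbabilityMeasure X), IsOpen G ∧ μ ∈ G ∧ ∃ K : ℝ, 0 < K ∧ ∀ n : ℕ,
      realWeight μ₀ w β (n + 1) (empirical ⁻¹' G) ≤
        ENNReal.ofReal (K * Real.exp (-a * ((n : ℝ) + 1))) := by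
  set F : ProbabilityMeasure X → ℝ := fun ν =>
    β * ∫ p, Φ p ∂((ν : Measure X).prod (ν : Measure X)) + ∫ x, φ x ∂(ν : Measure X)
  have hF : Continuous F := ((continuous_integral_prod_self Φ).const_mul β).add
    (ProbabilityMeasure.continuous_integral_continuousMap φ)
  obtain ⟨M, hM⟩ := exists_abs_le Φ
  -- On this set `N F` exceeds `N (a + log S)`, a Chebyshev bound for the tilt. The factor `e^{|β|
  -- M}` pays for the diagonal, and `S⁻¹` for having `S ^ n` instead of `S ^ (n + 1)`.
  refine ⟨{ν | a + Real.log S < F ν}, isOpen_lt continuous_const hF, ?_,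
    Real.exp (|β| * M) * (A * S⁻¹), by positivity, fun n => ?_⟩
  · simp only [Set.mem_ofPred_eq, F]; linarith
  set N : ℝ := (n : ℝ) + 1
  have hN : 0 < N := by positivity
  set G : Set (ProbabilityMeasure X) := {ν | a + Real.log S < F ν}
  have hGm : MeasurableSet ((empirical : (Fin (n + 1) → X) → ProbabilityMeasure X) ⁻¹' G) :=
    measurableSet_preimage_empirical (isOpen_lt continuous_const hF)
  rw [realWeight, withDensity_apply _ hGm]
  have hpt : ∀ x : Fin (n + 1) → X, empirical x ∈ G →
      ENNReal.ofReal (Real.exp (-β * realHamiltonian w (n + 1) x)) ≤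
        ENNReal.ofReal (Real.exp (|β| * M - N * (a + Real.log S))) *
          ENNReal.ofReal (Real.exp (realHamiltonian
            (fun p => -β * (w p - Φ p)) (n + 1) x + ∑ i, φ (x i))) := by
    intro x hx
    rw [← ENNReal.ofReal_mul (Real.exp_pos _).le, ← Real.exp_add]
    refine ENNReal.ofReal_le_ofReal (Real.exp_le_exp.2 ?_)
    have h1 : realHamiltonian (fun p => -β * (w p - Φ p)) (n + 1) x =
        -β * (realHamiltonian w (n + 1) x - realHamiltonian Φ (n + 1) x) := by
      rw [realHamiltonian_const_mul]
      congr 1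
      have := realHamiltonian_add (fun p => w p - Φ p) Φ (n + 1) x
      simp only [sub_add_cancel] at this
      rw [eq_sub_iff_add_eq]
      exact this.symm
    have h2 := abs_realHamiltonian_sub_le Φ.continuous.measurable hM x
    have h3 : N * ∫ y, φ y ∂(empirical x : Measure X) = ∑ i, φ (x i) := by
      rw [integral_empirical φ.continuous.measurable]
      push_cast
      rw [mul_inv_cancel_left₀ hN.ne']
    have h4 : N * (a + Real.log S) ≤ N * F (empirical x) :=
      mul_le_mul_of_nonneg_left (le_of_lt hx) hN.le
    have h5 : |β * (realHamiltonian Φ (n + 1) x - N *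
        ∫ p, Φ p ∂((empirical x : Measure X).prod (empirical x : Measure X)))| ≤ |β| * M := by
      rw [abs_mul]; gcongr
    have h6 := (abs_le.1 h5).1
    simp only [F] at h4
    rw [mul_add N (β * _), h3] at h4
    rw [h1]
    nlinarith
  calc _ ≤ ∫⁻ x in empirical ⁻¹' G, ENNReal.ofReal (Real.exp (|β| * M - N * (a + Real.log S))) *
          ENNReal.ofReal (Real.exp (realHamiltonian
            (fun p => -β * (w p - Φ p)) (n + 1) x + ∑ i, φ (x i))) ∂(Measure.pi fun _ => μ₀) :=
        setLIntegral_mono' hGm hpt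
    _ ≤ ∫⁻ x, ENNReal.ofReal (Real.exp (|β| * M - N * (a + Real.log S))) *
          ENNReal.ofReal (Real.exp (realHamiltonian
            (fun p => -β * (w p - Φ p)) (n + 1) x + ∑ i, φ (x i))) ∂(Measure.pi fun _ => μ₀) :=
        setLIntegral_le_lintegral _ _
    _ ≤ ENNReal.ofReal (Real.exp (|β| * M - N * (a + Real.log S))) *
          ENNReal.ofReal (A * S ^ n) := by
        rw [lintegral_const_mul' _ _ ENNReal.ofReal_ne_top]
        gcongr
        exact hbound n
    _ = _ := by
        rw [← ENNReal.ofReal_mul (Real.exp_pos _).le]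
        congr 1
        have : Real.exp (N * Real.log S) = S ^ (n + 1) := by
          rw [mul_comm, Real.exp_mul, Real.exp_log hS]
          rw [← Real.rpow_natCast S (n + 1)]
          push_cast
          rfl
        rw [show |β| * M - N * (a + Real.log S) = |β| * M + -a * N - N * Real.log S by ring,
          Real.exp_sub, Real.exp_add, this, pow_succ]
        field_simp

variable [IsProbabilityMeasure μ₀]

lemma integral_exp_pos_of_continuousMap (φ : C(X, ℝ)) : 0 < ∫ x, Real.exp (φ x) ∂μ₀ :=
  integral_exp_pos ((by fun_prop : Continuous fun x => Real.exp (φ x)).integrable_of_hasCompactSupport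
    (HasCompactSupport.of_compactSpace _))

lemma lintegral_exp_eq_of_continuousMap (φ : C(X, ℝ)) :
    ∫⁻ x, ENNReal.ofReal (Real.exp (φ x)) ∂μ₀ = ENNReal.ofReal (∫ x, Real.exp (φ x) ∂μ₀) :=
  (ofReal_integral_eq_lintegral_ofReal
    ((by fun_prop : Continuous fun x => Real.exp (φ x)).integrable_of_hasCompactSupport
      (HasCompactSupport.of_compactSpace _)) (ae_of_all _ fun _ => (Real.exp_pos _).le)).symm

end TiltedBound

namespace RealInteraction

variable {μ₀ : Measure X} [IsProbabilityMeasure μ₀] {w : X × X → ℝ} {Φ : ℕ → C(X × X, ℝ)}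
  {b₀ c : ℝ} {C : ℝ≥0∞}

/-- The exponential bound for a repulsive remainder. -/
lemma lintegral_tilted_le_of_nonneg (h : RealInteraction μ₀ w Φ b₀ c C) {β : ℝ} (hβ : 0 ≤ β)
    (φ : C(X, ℝ)) (k : ℕ) : ∃ A : ℝ, 0 < A ∧ ∀ n : ℕ,
      ∫⁻ x, ENNReal.ofReal (Real.exp (realHamiltonian (fun p => -β * (w p - Φ k p)) (n + 1) x +
        ∑ i, φ (x i))) ∂(Measure.pi fun _ => μ₀) ≤
          ENNReal.ofReal (A * (∫ x, Real.exp (φ x) ∂μ₀) ^ n) := by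
  obtain ⟨M, hM⟩ := exists_abs_le φ
  refine ⟨Real.exp M, Real.exp_pos _, fun n => ?_⟩
  rw [ENNReal.ofReal_mul (Real.exp_pos _).le,
    ENNReal.ofReal_pow (integral_exp_pos_of_continuousMap φ).le]
  have hw := h.measurable
  refine lintegral_exp_realHamiltonian_le μ₀ (by fun_prop) φ.continuous.measurable
    (fun x => (abs_le.1 (hM x)).2) (fun x => ?_) n
  rw [← lintegral_exp_eq_of_continuousMap]
  refine lintegral_mono_ae ?_
  filter_upwards [h.approx_le x] with y hy
  refine ENNReal.ofReal_le_ofReal (Real.exp_le_exp.2 ?_)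
  nlinarith [hy k]

set_option linter.unusedSectionVars false in
-- Because `w - c ≥ 0`, the moment of order `b₀` dominates those of all smaller orders, negative
-- ones included.
lemma lintegral_exp_le (h : RealInteraction μ₀ w Φ b₀ c C) {b : ℝ} (hb : b ≤ b₀) (x : X) :
    ∫⁻ y, ENNReal.ofReal (Real.exp (b * (w (x, y) - c))) ∂μ₀ ≤
      ENNReal.ofReal (Real.exp (-(b₀ * c))) * C := by
  have hw := h.measurable
  refine le_trans ?_ (mul_le_mul_right (h.exp_moment x) _)
  rw [← lintegral_const_mul _ (by fun_prop)]
  refine lintegral_mono fun y => ?_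
  rw [← ENNReal.ofReal_mul (Real.exp_pos _).le, ← Real.exp_add]
  refine ENNReal.ofReal_le_ofReal (Real.exp_le_exp.2 ?_)
  nlinarith [h.le_interaction (x, y)]

/-- The exponential integral of the interaction over its upper level sets is uniformly small. -/
lemma exists_tail_le (h : RealInteraction μ₀ w Φ b₀ c C) {b : ℝ} (hb : b < b₀) (A : ℝ)
    {ε : ℝ≥0∞} (hε : ε ≠ 0) : ∃ L : ℝ, c ≤ L ∧ ∀ x,
      ∫⁻ y, {y | L < w (x, y)}.indicator
        (fun y => ENNReal.ofReal (Real.exp (b * (w (x, y) - c) + A))) y ∂μ₀ ≤ ε := by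
  set D : ℝ≥0∞ := ENNReal.ofReal (Real.exp (-(b₀ * c))) * C
  have hD : D ≠ ⊤ := ENNReal.mul_ne_top ENNReal.ofReal_ne_top h.ne_top
  -- Where `w > L`, the order `b` is traded for `b₀`: `e^{b(w-c)} ≤ e^{-(b₀-b)(L-c)} e^{b₀(w-c)}`.
  -- The gap `b < b₀` gives decay uniform in `x`.
  have hlim : Tendsto (fun L : ℝ => ENNReal.ofReal (Real.exp (A - (b₀ - b) * (L - c))) * D) atTop
      (𝓝 0) := by
    have h1 : Tendsto (fun L : ℝ => A - (b₀ - b) * (L - c)) atTop atBot := by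
      have h2 : Tendsto (fun L : ℝ => (b₀ - b) * (L - c)) atTop atTop :=
        (tendsto_atTop_add_const_right _ (-c) tendsto_id).const_mul_atTop (sub_pos.2 hb)
      exact tendsto_const_nhds.add_atBot (tendsto_neg_atTop_atBot.comp h2)
    have h3 := ENNReal.tendsto_ofReal (Real.tendsto_exp_atBot.comp h1)
    rw [ENNReal.ofReal_zero] at h3
    simpa using ENNReal.Tendsto.mul_const h3 (Or.inr hD)
  obtain ⟨L, hL, hcL⟩ := ((hlim.eventually_le_const (pos_iff_ne_zero.2 hε)).and
    (eventually_ge_atTop c)).exists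
  refine ⟨L, hcL, fun x => le_trans ?_ hL⟩
  have hw := h.measurable
  refine le_trans ?_ (mul_le_mul_right (h.lintegral_exp_le le_rfl x) _)
  rw [← lintegral_const_mul _ (by fun_prop)]
  refine lintegral_mono fun y => ?_
  by_cases hy : L < w (x, y)
  · rw [Set.indicator_of_mem (by exact hy), ← ENNReal.ofReal_mul (Real.exp_pos _).le,
      ← Real.exp_add]
    refine ENNReal.ofReal_le_ofReal (Real.exp_le_exp.2 ?_)
    nlinarith
  · rw [Set.indicator_of_notMem (by exact hy)]
    exact zero_le

/-- The set of points where the approximation of the interaction is bad becomes small. -/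
lemma tendsto_measure_bad (h : RealInteraction μ₀ w Φ b₀ c C) {b : ℝ} (hb0 : 0 ≤ b) (hb : b ≤ b₀)
    (φ : C(X, ℝ)) {ε : ℝ} (hε : 0 < ε) :
    Tendsto (fun k => μ₀ {x | ENNReal.ofReal (∫ y, Real.exp (φ y) ∂μ₀ + ε) <
      ∫⁻ y, ENNReal.ofReal (Real.exp (b * (w (x, y) - Φ k (x, y)) + φ y)) ∂μ₀}) atTop (𝓝 0) := by
  obtain ⟨M, hM⟩ := exists_abs_le φ
  have hw := h.measurable
  set Z := ∫ y, Real.exp (φ y) ∂μ₀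
  set g : ℕ → X → ℝ≥0∞ := fun k x =>
    ∫⁻ y, ENNReal.ofReal (Real.exp (b * (w (x, y) - Φ k (x, y)) + φ y)) ∂μ₀
  have hgm : ∀ k, Measurable (g k) := fun k =>
    Measurable.lintegral_prod_right' (f := fun p : X × X =>
      ENNReal.ofReal (Real.exp (b * (w p - Φ k p) + φ p.2))) (by fun_prop)
  -- Dominated convergence is available only for each fixed `x`; it yields small measure of the bad
  -- set, not its absence for large `k`.
  have hg : ∀ x, Tendsto (fun k => g k x) atTop (𝓝 (ENNReal.ofReal Z)) := by
    intro x
    rw [← lintegral_exp_eq_of_continuousMap]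
    refine tendsto_lintegral_of_dominated_convergence
      (fun y => ENNReal.ofReal (Real.exp M) * ENNReal.ofReal (Real.exp (b * (w (x, y) - c))))
      (fun k => by fun_prop) (fun k => ae_of_all _ fun y => ?_) ?_ ?_
    · dsimp only
      rw [← ENNReal.ofReal_mul (Real.exp_pos _).le, ← Real.exp_add]
      refine ENNReal.ofReal_le_ofReal (Real.exp_le_exp.2 ?_)
      nlinarith [h.le_approx k (x, y), (abs_le.1 (hM y)).2]
    · rw [lintegral_const_mul _ (by fun_prop)]
      exact ENNReal.mul_ne_top ENNReal.ofReal_ne_top (ne_top_of_le_ne_top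
        (ENNReal.mul_ne_top ENNReal.ofReal_ne_top h.ne_top) (h.lintegral_exp_le hb x))
    · filter_upwards [h.tendsto x] with y hy
      have h1 : Tendsto (fun k => b * (w (x, y) - Φ k (x, y)) + φ y) atTop (𝓝 (φ y)) := by
        simpa using (((tendsto_const_nhds (x := w (x, y))).sub hy).const_mul b).add_const (φ y)
      exact ENNReal.tendsto_ofReal ((Real.continuous_exp.tendsto _).comp h1)
  have hZ : ENNReal.ofReal Z < ENNReal.ofReal (Z + ε) :=
    (ENNReal.ofReal_lt_ofReal_iff_of_nonneg (integral_exp_pos_of_continuousMap φ).le).2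
      (by linarith)
  have hmeas : ∀ k, MeasurableSet {x | ENNReal.ofReal (Z + ε) < g k x} := fun k =>
    measurableSet_lt measurable_const (hgm k)
  have key : Tendsto (fun k => ∫⁻ x, {x | ENNReal.ofReal (Z + ε) < g k x}.indicator 1 x ∂μ₀) atTop
      (𝓝 (∫⁻ _, 0 ∂μ₀)) := by
    refine tendsto_lintegral_of_dominated_convergence (fun _ => 1)
      (fun k => measurable_one.indicator (hmeas k))
      (fun k => ae_of_all _ fun x => Set.indicator_le_self' (fun _ _ => zero_le) x) (by simp)
      (ae_of_all _ fun x => ?_)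
    refine tendsto_const_nhds.congr' ?_
    filter_upwards [(hg x).eventually_lt_const hZ] with k hk
    rw [Set.indicator_of_notMem]
    simpa using hk.le
  simpa only [lintegral_indicator_one (hmeas _), lintegral_zero] using key

/-- The exponential bound for an attractive remainder. -/
lemma exists_lintegral_tilted_le (h : RealInteraction μ₀ w Φ b₀ c C) {b : ℝ} (hb0 : 0 ≤ b)
    (hb : b < b₀) (φ : C(X, ℝ)) {η : ℝ} (hη : 0 < η) : ∃ k, ∃ A : ℝ, 0 < A ∧ ∀ n : ℕ,
      ∫⁻ x, ENNReal.ofReal (Real.exp (realHamiltonian (fun p => b * (w p - Φ k p)) (n + 1) x +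
        ∑ i, φ (x i))) ∂(Measure.pi fun _ => μ₀) ≤
          ENNReal.ofReal (A * (∫ x, Real.exp (φ x) ∂μ₀ + η) ^ n) := by
  classical
  obtain ⟨A, hA⟩ := exists_abs_le φ
  have hA' : ∀ x, φ x ≤ A := fun x => (abs_le.1 (hA x)).2
  have hw := h.measurable
  set Z := ∫ x, Real.exp (φ x) ∂μ₀
  have hZ : 0 < Z := integral_exp_pos_of_continuousMap φ
  set η' : ℝ≥0∞ := ENNReal.ofReal (η / 3)
  have hη' : η' ≠ 0 := by simp [η', hη]
  -- Order of choice: `M` fixes the one-body cost `κ` and hence `E`; then `L` makes the tail small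
  -- even after multiplication by `E`; last, `k` makes the bad set `B` small compared with `E * D`.
  obtain ⟨M, hcM, hM⟩ := h.exists_tail_le hb A hη'
  set κ : ℝ := b * (M - c)
  have hκ : 0 ≤ κ := mul_nonneg hb0 (sub_nonneg.2 hcM)
  set E : ℝ≥0∞ := ENNReal.ofReal (Real.exp (2 * κ))
  have hE0 : E ≠ 0 := by simp [E, Real.exp_pos]
  have hEt : E ≠ ⊤ := ENNReal.ofReal_ne_top
  obtain ⟨L, hcL, hL⟩ := h.exists_tail_le hb A (ε := E⁻¹ * η')
    (mul_ne_zero (ENNReal.inv_ne_zero.2 hEt) hη')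
  set D : ℝ≥0∞ := ENNReal.ofReal (Real.exp (b * (L - c) + A))
  have hlim : Tendsto (fun k => E * D * μ₀ {x | ENNReal.ofReal (Z + η / 3) <
      ∫⁻ y, ENNReal.ofReal (Real.exp (b * (w (x, y) - Φ k (x, y)) + φ y)) ∂μ₀}) atTop (𝓝 0) := by
    simpa using ENNReal.Tendsto.const_mul (a := E * D)
      (h.tendsto_measure_bad hb0 hb.le φ (by positivity : 0 < η / 3))
      (Or.inr (ENNReal.mul_ne_top hEt ENNReal.ofReal_ne_top))
  obtain ⟨k, hk⟩ := (hlim.eventually_le_const (pos_iff_ne_zero.2 hη')).exists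
  set B : Set X := {x | ENNReal.ofReal (Z + η / 3) <
      ∫⁻ y, ENNReal.ofReal (Real.exp (b * (w (x, y) - Φ k (x, y)) + φ y)) ∂μ₀}
  have hB : MeasurableSet B := measurableSet_lt measurable_const
    (Measurable.lintegral_prod_right' (f := fun p : X × X =>
      ENNReal.ofReal (Real.exp (b * (w p - Φ k p) + φ p.2))) (by fun_prop))
  -- Off `T` a pair meets the bad set and has `w ≤ M`, so the remainder is at most `κ` and is
  -- charged to a bad particle through `u`. On `T` it is kept as the two-body term `V`.
  set T : Set (X × X) := {p | (p.1 ∉ B ∧ p.2 ∉ B) ∨ M < w p}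
  have hT : MeasurableSet T := by
    refine MeasurableSet.union (MeasurableSet.inter ?_ ?_) (measurableSet_lt measurable_const hw)
    · exact measurable_fst hB.compl
    · exact measurable_snd hB.compl
  set V : X × X → ℝ := T.indicator fun p => b * (w p - Φ k p)
  have hV : Measurable V := Measurable.indicator (by fun_prop) hT
  set u : X → ℝ := B.indicator fun _ => κ
  have hu : Measurable u := measurable_const.indicator hB
  have hu0 : ∀ x, 0 ≤ u x := fun x => Set.indicator_nonneg (fun _ _ => hκ) x
  have huκ : ∀ x, u x ≤ κ := fun x => Set.indicator_le_self' (fun _ _ => hκ) x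
  -- The factor `2` comes from the ordered pairs in `realHamiltonian_one_body_le`.
  set ψ : X → ℝ := fun x => φ x + 2 * u x
  have hψ : Measurable ψ := by simp only [ψ]; fun_prop
  have hR : ∀ p, b * (w p - Φ k p) ≤ b * (w p - c) := fun p =>
    mul_le_mul_of_nonneg_left (by linarith [h.le_approx k p]) hb0
  have hdom : ∀ p : X × X, b * (w p - Φ k p) ≤ V p + (u p.1 + u p.2) := by
    intro p
    by_cases hp : p ∈ T
    · simp only [V, Set.indicator_of_mem hp]
      linarith [hu0 p.1, hu0 p.2]
    · simp only [V, Set.indicator_of_notMem hp, zero_add]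
      simp only [T, Set.mem_ofPred_eq, not_or, not_and_or, not_not, not_lt] at hp
      have h1 : b * (w p - Φ k p) ≤ κ := (hR p).trans
        (mul_le_mul_of_nonneg_left (by linarith [hp.2]) hb0)
      rcases hp.1 with h2 | h2
      · have : u p.1 = κ := Set.indicator_of_mem h2 _
        linarith [hu0 p.2]
      · have : u p.2 = κ := Set.indicator_of_mem h2 _
        linarith [hu0 p.1]
  have hS : ∀ x, ∫⁻ y, ENNReal.ofReal (Real.exp (V (x, y) + ψ y)) ∂μ₀ ≤
      ENNReal.ofReal (Z + η) := by
    intro x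
    set tl : ℝ → X → ℝ≥0∞ := fun L => {y | L < w (x, y)}.indicator
        (fun y => ENNReal.ofReal (Real.exp (b * (w (x, y) - c) + A))) with htl
    have htlm : ∀ L, Measurable (tl L) := fun L =>
      Measurable.indicator (by fun_prop) (measurableSet_lt measurable_const (by fun_prop))
    -- The contribution of bad `y`: `E` accounts for the one-body term, and the rest is split
    -- according to whether `w ≤ L` or `w > L`.
    set rest : X → ℝ≥0∞ := fun y => E * (D * B.indicator 1 y + tl L y)
    have hrestm : Measurable rest :=
      ((((measurable_one.indicator hB).const_mul D).add (htlm L)).const_mul E)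
    have hrest : ∫⁻ y, rest y ∂μ₀ ≤ η' + η' := by
      have hm1 : Measurable fun y => D * B.indicator (1 : X → ℝ≥0∞) y :=
        (measurable_one.indicator hB).const_mul D
      have hm2 : Measurable fun y => D * B.indicator (1 : X → ℝ≥0∞) y + tl L y := hm1.add (htlm L)
      simp only [rest]
      rw [lintegral_const_mul _ hm2, lintegral_add_left hm1,
        lintegral_const_mul _ (measurable_one.indicator hB), lintegral_indicator_one hB, mul_add,
        ← mul_assoc]
      refine add_le_add hk ((mul_le_mul_right (hL x) E).trans ?_)
      rw [ENNReal.mul_inv_cancel_left hE0 hEt]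
    have hin : ∀ y ∈ B, ENNReal.ofReal (Real.exp (V (x, y) + ψ y)) ≤ rest y := by
      intro y hy
      have huy : u y = κ := Set.indicator_of_mem hy _
      simp only [ψ, huy, rest, Set.indicator_of_mem hy, Pi.one_apply, mul_one]
      rw [show V (x, y) + (φ y + 2 * κ) = 2 * κ + (V (x, y) + φ y) by ring, Real.exp_add,
        ENNReal.ofReal_mul (Real.exp_pos _).le]
      refine mul_le_mul_right ?_ E
      have hVle : V (x, y) ≤ b * (w (x, y) - c) := by
        by_cases hp : (x, y) ∈ T
        · simp only [V, Set.indicator_of_mem hp]; exact hR _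
        · simp only [V, Set.indicator_of_notMem hp]
          exact mul_nonneg hb0 (sub_nonneg.2 (h.le_interaction _))
      by_cases hy2 : L < w (x, y)
      · refine le_trans ?_ le_add_self
        simp only [tl]
        rw [Set.indicator_of_mem (by exact hy2)]
        exact ENNReal.ofReal_le_ofReal (Real.exp_le_exp.2 (by linarith [hA' y]))
      · refine le_trans ?_ le_self_add
        refine ENNReal.ofReal_le_ofReal (Real.exp_le_exp.2 ?_)
        have : b * (w (x, y) - c) ≤ b * (L - c) :=
          mul_le_mul_of_nonneg_left (by linarith) hb0
        linarith [hA' y]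
    have hZη : ∀ t : ℝ≥0∞, t ≤ ENNReal.ofReal (Z + η / 3) → t + (η' + η') ≤
        ENNReal.ofReal (Z + η) := by
      intro t ht
      refine (add_le_add_left ht _).trans_eq ?_
      simp only [η']
      rw [← ENNReal.ofReal_add (by positivity) (by positivity),
        ← ENNReal.ofReal_add (by positivity) (by positivity)]
      congr 1
      ring
    -- For bad `x` and good `y`, `V` survives only where `w > M`, which adds at most `η/3` to the
    -- integral of `e^φ`. For good `x`, the definition of `B` gives `Z + η/3` directly. Bad `y` add
    -- at most `2η/3` in both cases.
    by_cases hx : x ∈ B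
    · have hpt : ∀ y, ENNReal.ofReal (Real.exp (V (x, y) + ψ y)) ≤
          (ENNReal.ofReal (Real.exp (φ y)) + tl M y) + rest y := by
        intro y
        by_cases hy : y ∈ B
        · exact (hin y hy).trans le_add_self
        · refine le_trans ?_ le_self_add
          have huy : u y = 0 := Set.indicator_of_notMem hy _
          simp only [ψ, huy, mul_zero, add_zero]
          by_cases hy2 : M < w (x, y)
          · refine le_trans ?_ le_add_self
            have hp : (x, y) ∈ T := Or.inr hy2
            simp only [tl, V, Set.indicator_of_mem hp]
            rw [Set.indicator_of_mem (by exact hy2)]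
            exact ENNReal.ofReal_le_ofReal (Real.exp_le_exp.2 (add_le_add (hR _) (hA' y)))
          · have hp : (x, y) ∉ T := by
              simp only [T, Set.mem_ofPred_eq, not_or]
              exact ⟨fun h => h.1 hx, hy2⟩
            simp only [V, Set.indicator_of_notMem hp, zero_add]
            exact le_self_add
      refine (lintegral_mono hpt).trans ?_
      rw [lintegral_add_right _ hrestm, lintegral_add_right _ (htlm M),
        lintegral_exp_eq_of_continuousMap]
      refine (add_le_add_right hrest _).trans (hZη _ ?_)
      rw [ENNReal.ofReal_add hZ.le (by positivity)]
      exact add_le_add_right (hM x) _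
    · have hpt : ∀ y, ENNReal.ofReal (Real.exp (V (x, y) + ψ y)) ≤
          ENNReal.ofReal (Real.exp (b * (w (x, y) - Φ k (x, y)) + φ y)) + rest y := by
        intro y
        by_cases hy : y ∈ B
        · exact (hin y hy).trans le_add_self
        · refine le_trans ?_ le_self_add
          have huy : u y = 0 := Set.indicator_of_notMem hy _
          have hp : (x, y) ∈ T := Or.inl ⟨hx, hy⟩
          simp only [ψ, huy, mul_zero, add_zero, V, Set.indicator_of_mem hp]
          exact le_rfl
      refine (lintegral_mono hpt).trans ?_
      rw [lintegral_add_right _ hrestm]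
      refine (add_le_add_right hrest _).trans (hZη _ ?_)
      exact not_lt.1 hx
  refine ⟨k, Real.exp (A + 2 * κ), Real.exp_pos _, fun n => ?_⟩
  rw [ENNReal.ofReal_mul (Real.exp_pos _).le, ENNReal.ofReal_pow (by positivity)]
  refine le_trans (lintegral_mono fun x => ?_) (lintegral_exp_realHamiltonian_le μ₀ hV hψ
    (A := A + 2 * κ) (fun x => ?_) hS n)
  · refine ENNReal.ofReal_le_ofReal (Real.exp_le_exp.2 ?_)
    have h1 : realHamiltonian (fun p => b * (w p - Φ k p)) (n + 1) x ≤
        realHamiltonian (fun p => V p + (u p.1 + u p.2)) (n + 1) x :=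
      realHamiltonian_mono fun i j _ => hdom _
    rw [realHamiltonian_add] at h1
    have h2 := realHamiltonian_one_body_le hu0 x
    simp only [ψ, Finset.sum_add_distrib]
    linarith
  · simp only [ψ]
    linarith [hA' x, huκ x]

end RealInteraction

end MeanField

/-! ### The local upper bound -/

namespace MeanField

open InformationTheory

variable {X : Type*} [MetricSpace X] [CompactSpace X] [MeasurableSpace X] [BorelSpace X]

open Classical in
/-- The free energy functional of a real-valued interaction. -/
noncomputable def realFreeEnergy (μ₀ : Measure X) (w : X × X → ℝ) (β : ℝ)
    (μ : ProbabilityMeasure X) : EReal :=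
  if klDiv (μ : Measure X) μ₀ = ⊤ then ⊤
  else ((β * ∫ p, w p ∂((μ : Measure X).prod (μ : Measure X)) +
    (klDiv (μ : Measure X) μ₀).toReal : ℝ) : EReal)

namespace RealInteraction

variable {μ₀ : Measure X} [IsProbabilityMeasure μ₀] {w : X × X → ℝ} {Φ : ℕ → C(X × X, ℝ)}
  {b₀ c : ℝ} {C : ℝ≥0∞}

set_option linter.unusedSectionVars false in
lemma ae_prod (h : RealInteraction μ₀ w Φ b₀ c C) {μ : Measure X} [IsProbabilityMeasure μ]
    (hμ : μ ≪ μ₀) : ∀ᵐ p ∂(μ.prod μ), (∀ k, Φ k p ≤ w p) ∧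
      Tendsto (fun k => Φ k p) atTop (𝓝 (w p)) := by
  have hw := h.measurable
  have hm : MeasurableSet {p | (∀ k, Φ k p ≤ w p) ∧ Tendsto (fun k => Φ k p) atTop (𝓝 (w p))} := by
    refine MeasurableSet.inter ?_ ?_
    · exact measurableSet_setOfPred.2 (Measurable.forall fun k => measurableSet_setOfPred.1
        (measurableSet_le (Φ k).continuous.measurable hw))
    · exact measurableSet_tendsto_fun (fun k => (Φ k).continuous.measurable) hw
  refine (Measure.ae_prod_iff_ae_ae hm).2 (ae_of_all _ fun x => ?_)
  exact hμ.ae_le ((h.approx_le x).and (h.tendsto x))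

/-- The interaction is integrable with respect to measures of finite entropy. -/
lemma integrable (h : RealInteraction μ₀ w Φ b₀ c C) {μ : Measure X} [IsProbabilityMeasure μ]
    (hD : klDiv μ μ₀ ≠ ⊤) : Integrable w (μ.prod μ) := by
  have hw := h.measurable
  have hμ := (klDiv_ne_top_iff.1 hD).1
  have hfin : ∫⁻ p, ENNReal.ofReal (b₀ * (w p - c)) ∂(μ.prod μ) ≠ ⊤ := by
    rw [lintegral_prod _ (by fun_prop)]
    -- For each fixed `x`, entropy duality with `v = b₀ (w(x, ·) - c)` gives a bound independent of
    -- `x`.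
    refine ne_top_of_le_ne_top (b := klDiv μ μ₀ + ENNReal.ofReal (Real.exp (-(b₀ * c))) * C) ?_ ?_
    · exact ENNReal.add_ne_top.2 ⟨hD, ENNReal.mul_ne_top ENNReal.ofReal_ne_top h.ne_top⟩
    · calc _ ≤ ∫⁻ _, (klDiv μ μ₀ + ENNReal.ofReal (Real.exp (-(b₀ * c))) * C) ∂μ := by
            refine lintegral_mono fun x => ?_
            refine (lintegral_le_klDiv_add hμ (v := fun y => b₀ * (w (x, y) - c))
              (by fun_prop)).trans ?_
            exact add_le_add_right (h.lintegral_exp_le le_rfl x) _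
        _ = _ := by simp
  have hi : Integrable (fun p => b₀ * (w p - c)) (μ.prod μ) := by
    refine (lintegral_ofReal_ne_top_iff_integrable (by fun_prop) (ae_of_all _ fun p => ?_)).1 hfin
    exact mul_nonneg h.pos.le (sub_nonneg.2 (h.le_interaction p))
  have hi2 : Integrable (fun p => b₀⁻¹ * (b₀ * (w p - c)) + c) (μ.prod μ) :=
    (hi.const_mul b₀⁻¹).add (integrable_const c)
  refine hi2.congr (ae_of_all _ fun p => ?_)
  have := h.pos.ne'
  field_simp
  ring

lemma integrable_continuousMap {μ : Measure X} [IsProbabilityMeasure μ] (Ψ : C(X × X, ℝ)) :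
    Integrable Ψ (μ.prod μ) :=
  Ψ.continuous.integrable_of_hasCompactSupport (HasCompactSupport.of_compactSpace _)

lemma integral_approx_le (h : RealInteraction μ₀ w Φ b₀ c C) {μ : Measure X}
    [IsProbabilityMeasure μ] (hD : klDiv μ μ₀ ≠ ⊤) (k : ℕ) :
    ∫ p, Φ k p ∂(μ.prod μ) ≤ ∫ p, w p ∂(μ.prod μ) := by
  refine integral_mono_ae (integrable_continuousMap _) (h.integrable hD) ?_
  filter_upwards [h.ae_prod (klDiv_ne_top_iff.1 hD).1] with p hp using hp.1 k

lemma tendsto_integral_abs_sub (h : RealInteraction μ₀ w Φ b₀ c C) {μ : Measure X}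
    [IsProbabilityMeasure μ] (hD : klDiv μ μ₀ ≠ ⊤) :
    Tendsto (fun k => ∫ p, |w p - Φ k p| ∂(μ.prod μ)) atTop (𝓝 0) := by
  have hae := h.ae_prod (klDiv_ne_top_iff.1 hD).1
  have hw := h.measurable
  have key : Tendsto (fun k => ∫ p, |w p - Φ k p| ∂(μ.prod μ)) atTop
      (𝓝 (∫ _, (0 : ℝ) ∂(μ.prod μ))) := by
    refine tendsto_integral_of_dominated_convergence (fun p => w p - c)
      (fun k => by fun_prop) ((h.integrable hD).sub (integrable_const c)) (fun k => ?_) ?_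
    · filter_upwards [hae] with p hp
      rw [Real.norm_eq_abs, abs_abs, abs_of_nonneg (sub_nonneg.2 (hp.1 k))]
      linarith [h.le_approx k p]
    · filter_upwards [hae] with p hp
      simpa using ((tendsto_const_nhds (x := w p)).sub hp.2).abs
  simpa using key

lemma tendsto_integral_approx (h : RealInteraction μ₀ w Φ b₀ c C) {μ : Measure X}
    [IsProbabilityMeasure μ] (hD : klDiv μ μ₀ ≠ ⊤) :
    Tendsto (fun k => ∫ p, Φ k p ∂(μ.prod μ)) atTop (𝓝 (∫ p, w p ∂(μ.prod μ))) := by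
  rw [tendsto_iff_norm_sub_tendsto_zero]
  refine squeeze_zero (fun _ => norm_nonneg _) (fun k => ?_) (h.tendsto_integral_abs_sub hD)
  rw [← integral_sub (integrable_continuousMap _) (h.integrable hD)]
  refine (norm_integral_le_integral_norm _).trans_eq ?_
  simp only [Real.norm_eq_abs, abs_sub_comm]

/-- The upper bound for repulsive interactions; for `β = 0` it is the one in Sanov's theorem. -/
lemma exists_isOpen_le_of_nonneg (h : RealInteraction μ₀ w Φ b₀ c C) {β : ℝ} (hβ : 0 ≤ β)
    (μ : ProbabilityMeasure X) {a : ℝ} (ha : (a : EReal) < realFreeEnergy μ₀ w β μ) :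
    ∃ G : Set (ProbabilityMeasure X), IsOpen G ∧ μ ∈ G ∧ ∃ K : ℝ, 0 < K ∧ ∀ n : ℕ,
      realWeight μ₀ w β (n + 1) (empirical ⁻¹' G) ≤
        ENNReal.ofReal (K * Real.exp (-a * ((n : ℝ) + 1))) := by
  obtain ⟨k, φ, hlt⟩ : ∃ k, ∃ φ : C(X, ℝ),
      a < β * ∫ p, Φ k p ∂((μ : Measure X).prod (μ : Measure X)) +
        (∫ x, φ x ∂(μ : Measure X) - Real.log (∫ x, Real.exp (φ x) ∂μ₀)) := by
    by_cases hD : klDiv (μ : Measure X) μ₀ = ⊤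
    · obtain ⟨φ, hφ⟩ := exists_continuousMap_lt_of_lt_klDiv (μ := (μ : Measure X)) (μ₀ := μ₀)
        (a := a - β * ∫ p, Φ 0 p ∂((μ : Measure X).prod (μ : Measure X)))
        (by rw [hD]; exact EReal.coe_lt_top _)
      exact ⟨0, φ, by linarith⟩
    · rw [realFreeEnergy, if_neg hD, EReal.coe_lt_coe_iff] at ha
      have h1 := ((h.tendsto_integral_approx hD).const_mul β).add_const
        (klDiv (μ : Measure X) μ₀).toReal
      obtain ⟨k, hk⟩ := (h1.eventually_const_lt ha).exists
      obtain ⟨φ, hφ⟩ := exists_continuousMap_lt_of_lt_klDiv (μ := (μ : Measure X)) (μ₀ := μ₀)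
        (a := a - β * ∫ p, Φ k p ∂((μ : Measure X).prod (μ : Measure X)))
        (by rw [← EReal.coe_ennreal_toReal hD, EReal.coe_lt_coe_iff]; linarith)
      exact ⟨k, φ, by linarith⟩
  obtain ⟨A, hA, hb⟩ := h.lintegral_tilted_le_of_nonneg hβ φ k
  exact exists_isOpen_realWeight_le (Φ k) φ (integral_exp_pos_of_continuousMap φ) hA hb μ hlt

/-- Since `Φ k ≤ w` almost everywhere and `β ≤ 0`, replacing `w` by `Φ k` in the mean field energy
can only raise the rate. So `k` may be chosen last, depending on `φ` and `η`. -/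
lemma exists_isOpen_le_of_neg_of_ne_top (h : RealInteraction μ₀ w Φ b₀ c C) {β : ℝ} (hβ : β ≤ 0)
    (hβ₀ : -b₀ < β) (μ : ProbabilityMeasure X) (hD : klDiv (μ : Measure X) μ₀ ≠ ⊤) {a : ℝ}
    (ha : (a : EReal) < realFreeEnergy μ₀ w β μ) :
    ∃ G : Set (ProbabilityMeasure X), IsOpen G ∧ μ ∈ G ∧ ∃ K : ℝ, 0 < K ∧ ∀ n : ℕ,
      realWeight μ₀ w β (n + 1) (empirical ⁻¹' G) ≤
        ENNReal.ofReal (K * Real.exp (-a * ((n : ℝ) + 1))) := by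
  rw [realFreeEnergy, if_neg hD, EReal.coe_lt_coe_iff] at ha
  obtain ⟨φ, hφ⟩ := exists_continuousMap_lt_of_lt_klDiv (μ := (μ : Measure X)) (μ₀ := μ₀)
    (a := a - β * ∫ p, w p ∂((μ : Measure X).prod (μ : Measure X)))
    (by rw [← EReal.coe_ennreal_toReal hD, EReal.coe_lt_coe_iff]; linarith)
  have hZ : 0 < ∫ x, Real.exp (φ x) ∂μ₀ := integral_exp_pos_of_continuousMap φ
  obtain ⟨η, hη, hφη⟩ : ∃ η : ℝ, 0 < η ∧
      a - β * ∫ p, w p ∂((μ : Measure X).prod (μ : Measure X)) <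
        ∫ x, φ x ∂(μ : Measure X) - Real.log (∫ x, Real.exp (φ x) ∂μ₀ + η) := by
    have hc : Tendsto (fun η : ℝ => ∫ x, φ x ∂(μ : Measure X) -
        Real.log (∫ x, Real.exp (φ x) ∂μ₀ + η)) (𝓝[>] 0)
        (𝓝 (∫ x, φ x ∂(μ : Measure X) - Real.log (∫ x, Real.exp (φ x) ∂μ₀))) := by
      refine tendsto_const_nhds.sub (Tendsto.log ?_ hZ.ne')
      have : Tendsto (fun η : ℝ => ∫ x, Real.exp (φ x) ∂μ₀ + η) (𝓝 0)
          (𝓝 (∫ x, Real.exp (φ x) ∂μ₀ + 0)) := tendsto_const_nhds.add tendsto_id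
      rw [add_zero] at this
      exact this.mono_left nhdsWithin_le_nhds
    obtain ⟨η, h1, h2⟩ := ((hc.eventually_const_lt hφ).and self_mem_nhdsWithin).exists
    exact ⟨η, h2, h1⟩
  obtain ⟨k, A, hA, hb⟩ := h.exists_lintegral_tilted_le (b := -β) (by linarith) (by linarith) φ hη
  refine exists_isOpen_realWeight_le (Φ k) φ (by positivity) hA hb μ ?_
  have := h.integral_approx_le hD k
  nlinarith

set_option linter.unusedSectionVars false in
lemma lintegral_exp_realHamiltonian_le (h : RealInteraction μ₀ w Φ b₀ c C) (n : ℕ) :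
    ∫⁻ x, ENNReal.ofReal (Real.exp (b₀ * realHamiltonian w (n + 1) x))
      ∂(Measure.pi fun _ => μ₀) ≤ C ^ n := by
  have hw := h.measurable
  have := MeanField.lintegral_exp_realHamiltonian_le μ₀ (V := fun p => b₀ * w p) (by fun_prop)
    (φ := fun _ => 0) measurable_const (A := 0) (fun _ => le_rfl) (S := C)
    (by simpa using h.exp_moment) n
  simpa [realHamiltonian_const_mul] using this

/-- Configurations with `H ≤ L N` have weight at most `e^{-β L N}`, which the arbitrarily fast decay
in Sanov's bound beats. Those with `H ≥ L N` are rare by the exponential moment of order `b₀ > -β`.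
-/
lemma exists_isOpen_le_of_neg_of_eq_top (h : RealInteraction μ₀ w Φ b₀ c C) {β : ℝ} (hβ : β ≤ 0)
    (hβ₀ : -b₀ < β) (μ : ProbabilityMeasure X) (hD : klDiv (μ : Measure X) μ₀ = ⊤) (a : ℝ) :
    ∃ G : Set (ProbabilityMeasure X), IsOpen G ∧ μ ∈ G ∧ ∃ K : ℝ, 0 < K ∧ ∀ n : ℕ,
      realWeight μ₀ w β (n + 1) (empirical ⁻¹' G) ≤
        ENNReal.ofReal (K * Real.exp (-a * ((n : ℝ) + 1))) := by
  have hw := h.measurable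
  set B : ℝ := max C.toReal 1
  have hB1 : 1 ≤ B := le_max_right _ _
  have hCB : C ≤ ENNReal.ofReal B := by
    rw [← ENNReal.ofReal_toReal h.ne_top]
    exact ENNReal.ofReal_le_ofReal (le_max_left _ _)
  have hgap : 0 < b₀ + β := by linarith
  -- Chosen so that the gain `e^{-(b₀ + β) L N}` turns the moment bound `B ^ N` into `e^{-a N}`.
  set L : ℝ := (a + Real.log B) / (b₀ + β)
  have hL : (b₀ + β) * L = a + Real.log B := mul_div_cancel₀ _ hgap.ne'
  obtain ⟨G, hG, hμG, K, hK, hb⟩ := h.exists_isOpen_le_of_nonneg le_rfl μ (a := a - β * L)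
    (by rw [realFreeEnergy, if_pos hD]; exact EReal.coe_lt_top _)
  refine ⟨G, hG, hμG, K + 1, by positivity, fun n => ?_⟩
  set N : ℝ := (n : ℝ) + 1
  have hN : 0 < N := by positivity
  have hGm : MeasurableSet ((empirical : (Fin (n + 1) → X) → ProbabilityMeasure X) ⁻¹' G) :=
    measurableSet_preimage_empirical hG
  have hHm : Measurable (realHamiltonian w (n + 1)) := measurable_realHamiltonian hw _
  have hpt : ∀ x, ENNReal.ofReal (Real.exp (-β * realHamiltonian w (n + 1) x)) ≤
      ENNReal.ofReal (Real.exp (-β * L * N)) + ENNReal.ofReal (Real.exp (-(b₀ + β) * L * N)) *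
        ENNReal.ofReal (Real.exp (b₀ * realHamiltonian w (n + 1) x)) := by
    intro x
    rcases le_total (realHamiltonian w (n + 1) x) (L * N) with hx | hx
    · refine le_trans (ENNReal.ofReal_le_ofReal (Real.exp_le_exp.2 ?_)) le_self_add
      nlinarith
    · refine le_trans ?_ le_add_self
      rw [← ENNReal.ofReal_mul (Real.exp_pos _).le, ← Real.exp_add]
      refine ENNReal.ofReal_le_ofReal (Real.exp_le_exp.2 ?_)
      nlinarith
  have hzero : realWeight μ₀ w 0 (n + 1) = Measure.pi fun _ => μ₀ := by
    simp [realWeight]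
  rw [realWeight, withDensity_apply _ hGm]
  calc _ ≤ ∫⁻ x in empirical ⁻¹' G, (ENNReal.ofReal (Real.exp (-β * L * N)) +
          ENNReal.ofReal (Real.exp (-(b₀ + β) * L * N)) *
            ENNReal.ofReal (Real.exp (b₀ * realHamiltonian w (n + 1) x)))
              ∂(Measure.pi fun _ => μ₀) := lintegral_mono hpt
    _ ≤ ENNReal.ofReal (Real.exp (-β * L * N)) *
          ENNReal.ofReal (K * Real.exp (-(a - β * L) * N)) +
        ENNReal.ofReal (Real.exp (-(b₀ + β) * L * N)) * ENNReal.ofReal B ^ n := by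
        rw [lintegral_add_left measurable_const, lintegral_const_mul _ (by fun_prop),
          setLIntegral_const]
        gcongr
        · rw [← hzero]; exact hb n
        · refine (setLIntegral_le_lintegral _ _).trans
            ((h.lintegral_exp_realHamiltonian_le n).trans ?_)
          exact pow_le_pow_left' hCB n
    _ ≤ ENNReal.ofReal (K * Real.exp (-a * N)) + ENNReal.ofReal (1 * Real.exp (-a * N)) := by
        rw [← ENNReal.ofReal_pow (by positivity), ← ENNReal.ofReal_mul (Real.exp_pos _).le,
          ← ENNReal.ofReal_mul (Real.exp_pos _).le]
        refine add_le_add (ENNReal.ofReal_le_ofReal (le_of_eq ?_)) (ENNReal.ofReal_le_ofReal ?_)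
        · rw [mul_left_comm, ← Real.exp_add]
          ring_nf
        · have h1 : B ^ n ≤ Real.exp (N * Real.log B) := by
            rw [mul_comm, Real.exp_mul, Real.exp_log (by positivity),
              ← Real.rpow_natCast B n]
            exact Real.rpow_le_rpow_of_exponent_le hB1 (by simp [N])
          calc Real.exp (-(b₀ + β) * L * N) * B ^ n
              ≤ Real.exp (-(b₀ + β) * L * N) * Real.exp (N * Real.log B) := by gcongr
            _ = 1 * Real.exp (-a * N) := by
              rw [← Real.exp_add, one_mul]
              congr 1
              linear_combination (-N) * hL
    _ = _ := by
        rw [← ENNReal.ofReal_add (by positivity) (by positivity), add_mul]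

theorem localUpperBound (h : RealInteraction μ₀ w Φ b₀ c C) {β : ℝ} (hβ : -b₀ < β) :
    LocalUpperBound (fun n => empiricalLaw (realWeight μ₀ w β (n + 1)))
      (realFreeEnergy μ₀ w β) := by
  intro μ a ha
  have : ∃ G : Set (ProbabilityMeasure X), IsOpen G ∧ μ ∈ G ∧ ∃ K : ℝ, 0 < K ∧ ∀ n : ℕ,
      realWeight μ₀ w β (n + 1) (empirical ⁻¹' G) ≤
        ENNReal.ofReal (K * Real.exp (-a * ((n : ℝ) + 1))) := by
    rcases le_total 0 β with h0 | h0
    · exact h.exists_isOpen_le_of_nonneg h0 μ ha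
    · by_cases hD : klDiv (μ : Measure X) μ₀ = ⊤
      · exact h.exists_isOpen_le_of_neg_of_eq_top h0 hβ μ hD a
      · exact h.exists_isOpen_le_of_neg_of_ne_top h0 hβ μ hD ha
  obtain ⟨G, hG, hμG, K, hK, hb⟩ := this
  refine ⟨G, hG, hμG, K, hK, Eventually.of_forall fun n => ?_⟩
  rw [empiricalLaw_apply _ (MeasurableSpace.measurableSet_generateFrom hG)]
  exact hb n

end RealInteraction

end MeanField

/-! ### Weak laws of large numbers -/

namespace MeanField

open InformationTheory

variable {X : Type*} [MetricSpace X] [CompactSpace X] [MeasurableSpace X] [BorelSpace X]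

/-- With no interaction the upper bound is Sanov's, for an arbitrary reference law; its rate is
positive away from that law, which gives the law of large numbers. -/
lemma RealInteraction.zero {X : Type*} [MetricSpace X] [MeasurableSpace X] (μ : Measure X) [IsProbabilityMeasure μ] :
    RealInteraction μ (fun _ => 0) (fun _ => 0) 1 0 1 where
  measurable := measurable_const
  le_interaction _ := le_rfl
  le_approx _ _ := le_rfl
  approx_le _ := ae_of_all _ fun _ _ => le_rfl
  tendsto _ := ae_of_all _ fun _ => tendsto_const_nhds
  pos := one_pos
  exp_moment _ := by simp
  ne_top := ENNReal.one_ne_top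

section LawOfLargeNumbers

/-- The empirical measure of independent particles with law `μ` converges to `μ` in probability. -/
theorem tendsto_pi_empirical (μ : ProbabilityMeasure X) {G : Set (ProbabilityMeasure X)}
    (hG : IsOpen G) (hμ : μ ∈ G) :
    Tendsto (fun n : ℕ => (Measure.pi fun _ : Fin (n + 1) => (μ : Measure X)) (empirical ⁻¹' Gᶜ))
      atTop (𝓝 0) := by
  refine hG.isClosed_compl.isCompact.induction_on (p := fun s => Tendsto (fun n : ℕ =>
    (Measure.pi fun _ : Fin (n + 1) => (μ : Measure X)) (empirical ⁻¹' s)) atTop (𝓝 0)) ?_ ?_ ?_ ?_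
  · simp
  · intro s t hst ht
    exact tendsto_of_tendsto_of_tendsto_of_le_of_le tendsto_const_nhds ht (fun _ => zero_le)
      fun n => measure_mono (Set.preimage_mono hst)
  · intro s t hs ht
    have h := hs.add ht
    rw [add_zero] at h
    refine tendsto_of_tendsto_of_tendsto_of_le_of_le tendsto_const_nhds h (fun _ => zero_le)
      fun n => ?_
    rw [Set.preimage_union]
    exact measure_union_le _ _
  · intro ν hν
    have hne : (ν : Measure X) ≠ μ := fun h =>
      hν (by rwa [ProbabilityMeasure.toMeasure_injective h])
    have hpos : (0 : EReal) < realFreeEnergy (μ : Measure X) (fun _ => 0) 0 ν := by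
      have h0 : klDiv (ν : Measure X) (μ : Measure X) ≠ 0 := fun h => hne (klDiv_eq_zero_iff.1 h)
      rw [realFreeEnergy]
      split_ifs with hD
      · exact EReal.zero_lt_top
      · rw [EReal.coe_pos, zero_mul, zero_add]
        exact ENNReal.toReal_pos h0 hD
    obtain ⟨a, ha0, ha⟩ := EReal.lt_iff_exists_real_btwn.1 hpos
    obtain ⟨U, hU, hνU, K, hK, hb⟩ :=
      (RealInteraction.zero (μ : Measure X)).exists_isOpen_le_of_nonneg le_rfl ν ha
    refine ⟨U, mem_nhdsWithin_of_mem_nhds (hU.mem_nhds hνU), ?_⟩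
    have ha' : 0 < a := by exact_mod_cast ha0
    have hlim : Tendsto (fun n : ℕ => ENNReal.ofReal (K * Real.exp (-a * ((n : ℝ) + 1)))) atTop
        (𝓝 0) := by
      have h1 : Tendsto (fun n : ℕ => -a * ((n : ℝ) + 1)) atTop atBot :=
        (tendsto_atTop_add_const_right _ _ tendsto_natCast_atTop_atTop).const_mul_atTop_of_neg
          (by linarith)
      have h2 := ((Real.tendsto_exp_atBot.comp h1).const_mul K)
      rw [mul_zero] at h2
      simpa using ENNReal.tendsto_ofReal h2
    refine tendsto_of_tendsto_of_tendsto_of_le_of_le tendsto_const_nhds hlim (fun _ => zero_le)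
      fun n => ?_
    have := hb n
    simpa [realWeight] using this

/-- The weak law of large numbers for the mean of an integrable function over pairs of
independent particles. -/
theorem tendsto_pi_realHamiltonian (μ : ProbabilityMeasure X) {V : X × X → ℝ} (hVm : Measurable V)
    (hV : Integrable V ((μ : Measure X).prod (μ : Measure X))) {ε : ℝ} (hε : 0 < ε) :
    Tendsto (fun n : ℕ => (Measure.pi fun _ : Fin (n + 1) => (μ : Measure X))
      {x | ε ≤ |realHamiltonian V (n + 1) x / ((n : ℝ) + 1) -
        ∫ p, V p ∂((μ : Measure X).prod (μ : Measure X))|}) atTop (𝓝 0) := by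
  rw [ENNReal.tendsto_nhds_zero]
  intro δ hδ
  obtain ⟨τ, hτ, hτε, hτδ⟩ : ∃ τ : ℝ, 0 < τ ∧ τ ≤ ε / 4 ∧
      ENNReal.ofReal τ / ENNReal.ofReal (ε / 4) ≤ δ / 2 := by
    have hlim : Tendsto (fun τ : ℝ => ENNReal.ofReal τ / ENNReal.ofReal (ε / 4)) (𝓝[>] 0)
        (𝓝 0) := by
      have h1 : Tendsto ENNReal.ofReal (𝓝[>] 0) (𝓝 0) := by
        simpa using (ENNReal.tendsto_ofReal (tendsto_id (x := 𝓝 (0 : ℝ)))).mono_left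
          nhdsWithin_le_nhds
      simpa using ENNReal.Tendsto.div_const h1 (Or.inr (by simp [hε]))
    have h2 : ∀ᶠ τ : ℝ in 𝓝[>] 0, τ ≤ ε / 4 :=
      nhdsWithin_le_nhds (Iic_mem_nhds (by positivity))
    obtain ⟨τ, h3, h4, h5⟩ := ((hlim.eventually_le_const (ENNReal.half_pos hδ.ne')).and
      (h2.and self_mem_nhdsWithin)).exists
    exact ⟨τ, h5, h4, h3⟩
  obtain ⟨g, hg, hgi⟩ := hV.exists_boundedContinuous_integral_sub_le hτ
  set Ψ : C(X × X, ℝ) := g.toContinuousMap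
  replace hgi : Integrable Ψ ((μ : Measure X).prod (μ : Measure X)) := hgi
  obtain ⟨M, hM⟩ := exists_abs_le Ψ
  set I : ProbabilityMeasure X → ℝ := fun ν => ∫ p, Ψ p ∂((ν : Measure X).prod (ν : Measure X))
  set G : Set (ProbabilityMeasure X) := {ν | |I ν - I μ| < ε / 4}
  have hG : IsOpen G := isOpen_lt (((continuous_integral_prod_self Ψ).sub continuous_const).abs)
    continuous_const
  have hμG : μ ∈ G := by simp [G, hε]
  have h1 := ENNReal.tendsto_nhds_zero.1 (tendsto_pi_empirical μ hG hμG) (δ / 2)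
    (ENNReal.half_pos hδ.ne')
  have h2 : ∀ᶠ n : ℕ in atTop, M / (ε / 4) ≤ n := tendsto_natCast_atTop_atTop.eventually_ge_atTop _
  filter_upwards [h1, h2] with n hn1 hn2
  set N : ℝ := (n : ℝ) + 1
  have hN : 0 < N := by positivity
  set P := Measure.pi fun _ : Fin (n + 1) => (μ : Measure X)
  set R : X × X → ℝ := fun p => V p - Ψ p
  have hRm : Measurable R := hVm.sub Ψ.continuous.measurable
  -- The deviation `ε` is shared out: `ε/4` each for the limit of `Ψ` against that of `V`, the
  -- fluctuation of `Ψ`, the remainder `V - Ψ` (by Markov's inequality), and the diagonal.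
  have hsub : {x : Fin (n + 1) → X | ε ≤ |realHamiltonian V (n + 1) x / N -
        ∫ p, V p ∂((μ : Measure X).prod (μ : Measure X))|} ⊆
      empirical ⁻¹' Gᶜ ∪ {x | ENNReal.ofReal (ε / 4 * N) ≤
        ENNReal.ofReal |realHamiltonian R (n + 1) x|} := by
    intro x hx
    by_contra hcon
    simp only [Set.mem_union, not_or, Set.mem_preimage, Set.mem_compl_iff, not_not,
      Set.mem_ofPred_eq, not_le] at hcon
    have h3 : |I (empirical x) - I μ| < ε / 4 := hcon.1
    have h4 : |realHamiltonian R (n + 1) x| < ε / 4 * N := (ENNReal.ofReal_lt_ofReal_iff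
      (by positivity)).1 hcon.2
    have h5 := abs_realHamiltonian_sub_le Ψ.continuous.measurable hM x
    change |realHamiltonian Ψ (n + 1) x - N * I (empirical x)| ≤ M at h5
    have h6 : |I μ - ∫ p, V p ∂((μ : Measure X).prod (μ : Measure X))| ≤ ε / 4 := by
      refine le_trans ?_ (hg.trans hτε)
      simp only [I]
      rw [abs_sub_comm, ← integral_sub hV hgi]
      exact norm_integral_le_integral_norm fun p => V p - Ψ p
    have h7 : realHamiltonian V (n + 1) x =
        realHamiltonian R (n + 1) x + realHamiltonian Ψ (n + 1) x := by
      rw [← realHamiltonian_add R Ψ]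
      simp [R]
    have h8 : M < ε / 4 * N := by
      rw [div_le_iff₀ (by positivity)] at hn2
      simp only [N]
      nlinarith
    have hx' : ε ≤ |realHamiltonian V (n + 1) x / N -
        ∫ p, V p ∂((μ : Measure X).prod (μ : Measure X))| := hx
    have h9 : |realHamiltonian V (n + 1) x / N - I (empirical x)| < ε / 2 := by
      have : realHamiltonian V (n + 1) x / N - I (empirical x) =
          (realHamiltonian R (n + 1) x + (realHamiltonian Ψ (n + 1) x - N * I (empirical x))) / N := by
        rw [h7]; field_simp; ring
      rw [this, abs_div, abs_of_pos hN, div_lt_iff₀ hN]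
      have := abs_add_le (realHamiltonian R (n + 1) x)
        (realHamiltonian Ψ (n + 1) x - N * I (empirical x))
      linarith
    rw [abs_lt] at h3 h9
    rw [abs_le] at h6
    rcases le_abs.1 hx' with h | h <;> linarith
  refine (measure_mono hsub).trans ((measure_union_le _ _).trans ?_)
  rw [← ENNReal.add_halves δ]
  refine add_le_add hn1 ?_
  have hHm := measurable_realHamiltonian hRm (n + 1)
  refine (meas_ge_le_lintegral_div (by fun_prop) (by simp; positivity)
    ENNReal.ofReal_ne_top).trans (le_trans ?_ hτδ)
  have h10 : ∫⁻ p, ENNReal.ofReal |R p| ∂((μ : Measure X).prod (μ : Measure X)) ≤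
      ENNReal.ofReal τ := by
    have hRi : Integrable (fun p => |R p|) ((μ : Measure X).prod (μ : Measure X)) :=
      (hV.sub hgi).abs
    rw [← ofReal_integral_eq_lintegral_ofReal hRi (ae_of_all _ fun _ => abs_nonneg _)]
    exact ENNReal.ofReal_le_ofReal hg
  have hN' : ((n + 1 : ℕ) : ℝ≥0∞) = ENNReal.ofReal N := by
    rw [← ENNReal.ofReal_natCast]; simp [N]
  calc _ ≤ (((n + 1 : ℕ) : ℝ≥0∞) * ENNReal.ofReal τ) / ENNReal.ofReal (ε / 4 * N) := by
        gcongr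
        exact (lintegral_abs_realHamiltonian_le _ hRm _).trans (mul_le_mul_right h10 _)
    _ = _ := by
        rw [hN', ENNReal.ofReal_mul (by positivity), mul_comm (ENNReal.ofReal (ε / 4)),
          ENNReal.mul_div_mul_left _ _ (by simp [hN]) ENNReal.ofReal_ne_top]

end LawOfLargeNumbers

lemma realHamiltonian_fst {X : Type*} (g : X → ℝ) (n : ℕ) (x : Fin (n + 1) → X) :
    realHamiltonian (fun p => g p.1) (n + 1) x = n / ((n : ℝ) + 1) * ∑ i, g (x i) := by
  rw [realHamiltonian, sum_offDiag_eq_sum_succAbove (fun i _ => g (x i))]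
  simp only [Finset.sum_const, Finset.card_univ, Fintype.card_fin, nsmul_eq_mul, ← Finset.mul_sum]
  push_cast
  ring

/-! ### The local lower bound -/

namespace RealInteraction

variable {μ₀ : Measure X} [IsProbabilityMeasure μ₀] {w : X × X → ℝ} {Φ : ℕ → C(X × X, ℝ)}
  {b₀ c : ℝ} {C : ℝ≥0∞}

/-- Change of measure: under `μ^{⊗N}` an event `B` inside the neighbourhood, with energy and
log-density near their means, has probability at least `1/2`. Its Gibbs weight is then at least
`e^{-N(βE + D + (|β| + 2)ε)} / 2`. -/
theorem localLowerBound (h : RealInteraction μ₀ w Φ b₀ c C) (β : ℝ) :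
    LocalLowerBound (fun n => empiricalLaw (realWeight μ₀ w β (n + 1)))
      (realFreeEnergy μ₀ w β) := by
  intro μ a ha G hG hμG
  have hw := h.measurable
  by_cases hD : klDiv (μ : Measure X) μ₀ = ⊤
  · rw [realFreeEnergy, if_pos hD] at ha
    exact absurd ha not_top_lt
  rw [realFreeEnergy, if_neg hD, EReal.coe_lt_coe_iff] at ha
  obtain ⟨hμ, hllr⟩ := klDiv_ne_top_iff.1 hD
  set D : ℝ := (klDiv (μ : Measure X) μ₀).toReal
  set E : ℝ := ∫ p, w p ∂((μ : Measure X).prod (μ : Measure X))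
  set ℓ : X → ℝ := llr (μ : Measure X) μ₀
  have hℓm : Measurable ℓ := measurable_llr _ _
  have hDℓ : D = ∫ p, ℓ p.1 ∂((μ : Measure X).prod (μ : Measure X)) := by
    rw [integral_fun_fst]
    simp [D, ℓ, toReal_klDiv_of_measure_eq hμ (by simp)]
  obtain ⟨ε, hε, hεa⟩ : ∃ ε : ℝ, 0 < ε ∧ β * E + D + (|β| + 2) * ε ≤ a := by
    refine ⟨(a - (β * E + D)) / (|β| + 2), div_pos (by linarith) (by positivity), ?_⟩
    rw [mul_div_cancel₀ _ (by positivity)]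
    linarith
  set f : X → ℝ≥0∞ := fun x => ENNReal.ofReal ((μ : Measure X).rnDeriv μ₀ x).toReal
  have hfm : Measurable f := ((Measure.measurable_rnDeriv _ _).ennreal_toReal).ennreal_ofReal
  have hμf : μ₀.withDensity f = (μ : Measure X) := by
    rw [← Measure.withDensity_rnDeriv_eq _ _ hμ]
    refine withDensity_congr_ae ?_
    filter_upwards [(μ : Measure X).rnDeriv_lt_top μ₀] with x hx
    exact ENNReal.ofReal_toReal hx.ne
  -- Only an inequality: where the density vanishes, `Real.log 0 = 0` makes the right-hand side `1`.
  have hfℓ : ∀ x, f x ≤ ENNReal.ofReal (Real.exp (ℓ x)) := fun x => by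
    refine ENNReal.ofReal_le_ofReal ?_
    simp only [ℓ, llr]
    exact Real.le_exp_log _
  have hprob : IsProbabilityMeasure (μ₀.withDensity f) := by rw [hμf]; infer_instance
  have t1 := tendsto_pi_empirical μ hG hμG
  have t2 := tendsto_pi_realHamiltonian μ hw (h.integrable hD) hε
  -- A function of the first particle alone is treated as a pair interaction, so one law of large
  -- numbers serves both energy and entropy.
  have t3 := tendsto_pi_realHamiltonian μ (V := fun p => ℓ p.1) (by fun_prop)
    (hllr.comp_fst _) hε
  have t4 := (t1.add t2).add t3
  simp only [add_zero] at t4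
  have e1 := t4.eventually_le_const (ENNReal.half_pos one_ne_zero : (0 : ℝ≥0∞) < 1 / 2)
  -- The sum over pairs carries a factor `n/(n+1)`; this bound says `(D + ε)(n + 1) ≤ n (D + 2ε)`,
  -- so removing the factor costs another `ε`.
  have e2 : ∀ᶠ n : ℕ in atTop, max ((D + ε) / ε) 1 ≤ n :=
    tendsto_natCast_atTop_atTop.eventually_ge_atTop _
  refine ⟨1 / 2, by norm_num, ?_⟩
  filter_upwards [e1, e2] with n hn1 hn2
  rw [empiricalLaw_apply _ (MeasurableSpace.measurableSet_generateFrom hG)]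
  have hGm : MeasurableSet ((empirical : (Fin (n + 1) → X) → ProbabilityMeasure X) ⁻¹' G) :=
    measurableSet_preimage_empirical hG
  set N : ℝ := (n : ℝ) + 1
  have hN : 0 < N := by positivity
  set P := Measure.pi fun _ : Fin (n + 1) => (μ : Measure X)
  set B2 := {x : Fin (n + 1) → X | ε ≤ |realHamiltonian w (n + 1) x / N - E|}
  set B3 := {x : Fin (n + 1) → X | ε ≤ |realHamiltonian (fun p => ℓ p.1) (n + 1) x / N -
    ∫ p, ℓ p.1 ∂((μ : Measure X).prod (μ : Measure X))|}
  have hB2 : MeasurableSet B2 := measurableSet_le measurable_const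
    ((((measurable_realHamiltonian hw _).div_const _).sub_const _).abs)
  have hB3 : MeasurableSet B3 := measurableSet_le measurable_const
    ((((measurable_realHamiltonian (by fun_prop) _).div_const _).sub_const _).abs)
  set B : Set (Fin (n + 1) → X) := (empirical ⁻¹' Gᶜ ∪ B2 ∪ B3)ᶜ
  have hBm : MeasurableSet B := by
    refine MeasurableSet.compl (MeasurableSet.union (MeasurableSet.union ?_ hB2) hB3)
    exact hGm.compl
  have hPB : 1 / 2 ≤ P B := by
    have h1 : P Bᶜ ≤ 1 / 2 := by
      rw [compl_compl]
      exact (measure_union_le _ _).trans ((add_le_add_left (measure_union_le _ _) _).trans hn1)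
    have h2 : P B + P Bᶜ = 1 := by rw [measure_add_measure_compl hBm]; simp [P]
    by_contra! hlt
    have : P B + P Bᶜ < 1 := by
      calc P B + P Bᶜ < 1 / 2 + 1 / 2 := ENNReal.add_lt_add_of_lt_of_le
            (ne_top_of_le_ne_top (by simp) h1) hlt h1
        _ = 1 := ENNReal.add_halves 1
    exact absurd h2 this.ne
  have hBG : B ⊆ empirical ⁻¹' G := fun x hx => by
    simp only [B, Set.mem_compl_iff, Set.mem_union, not_or, Set.preimage_compl, not_not] at hx
    exact hx.1.1
  have hBE : ∀ x ∈ B, -N * (β * E + |β| * ε) ≤ -β * realHamiltonian w (n + 1) x := by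
    intro x hx
    simp only [B, Set.mem_compl_iff, Set.mem_union, not_or] at hx
    have h1 : |realHamiltonian w (n + 1) x / N - E| < ε := not_le.1 hx.1.2
    have h2 : |β * (realHamiltonian w (n + 1) x / N - E)| ≤ |β| * ε := by
      rw [abs_mul]; gcongr
    have h3 := mul_le_mul_of_nonneg_left (abs_le.1 h2).2 hN.le
    have h4 : N * (β * (realHamiltonian w (n + 1) x / N - E)) =
        β * realHamiltonian w (n + 1) x - N * (β * E) := by
      field_simp
    rw [h4] at h3
    linarith
  have hBD : ∀ x ∈ B, ∑ i, ℓ (x i) ≤ N * (D + 2 * ε) := by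
    intro x hx
    simp only [B, Set.mem_compl_iff, Set.mem_union, not_or] at hx
    have h1 : |realHamiltonian (fun p => ℓ p.1) (n + 1) x / N - D| < ε := by
      rw [hDℓ]; exact not_le.1 hx.2
    have h2 := (abs_lt.1 h1).2
    have hn0 : (1 : ℝ) ≤ n := (le_max_right _ _).trans hn2
    have hn3 : (D + ε) / ε ≤ n := (le_max_left _ _).trans hn2
    rw [div_le_iff₀ hε] at hn3
    rw [realHamiltonian_fst] at h2
    have h3 : (n : ℝ) * ∑ i, ℓ (x i) < (D + ε) * (N * N) := by
      have : (n : ℝ) / N * (∑ i, ℓ (x i)) / N < D + ε := by linarith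
      rw [div_mul_eq_mul_div, div_div, div_lt_iff₀ (by positivity)] at this
      exact this
    have h4 : (D + ε) * (N * N) ≤ n * (N * (D + 2 * ε)) := by
      have : (D + ε) * N ≤ n * (D + 2 * ε) := by simp only [N]; nlinarith
      calc (D + ε) * (N * N) = N * ((D + ε) * N) := by ring
        _ ≤ N * (n * (D + 2 * ε)) := by gcongr
        _ = _ := by ring
    exact le_of_mul_le_mul_left (h3.le.trans h4) (by linarith)
  have hPle : P B ≤ ENNReal.ofReal (Real.exp (N * (D + 2 * ε))) *
      (Measure.pi fun _ : Fin (n + 1) => μ₀) B := by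
    have hP : P = (Measure.pi fun _ : Fin (n + 1) => μ₀).withDensity fun x => ∏ i, f (x i) := by
      rw [← pi_withDensity μ₀ hfm]
      simp only [P, hμf]
    rw [hP, withDensity_apply _ hBm, ← setLIntegral_const]
    refine setLIntegral_mono measurable_const fun x hx => ?_
    calc ∏ i, f (x i) ≤ ∏ i, ENNReal.ofReal (Real.exp (ℓ (x i))) :=
          Finset.prod_le_prod' fun i _ => hfℓ _
      _ = ENNReal.ofReal (Real.exp (∑ i, ℓ (x i))) := by
          rw [Real.exp_sum, ENNReal.ofReal_prod_of_nonneg fun _ _ => (Real.exp_pos _).le]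
      _ ≤ _ := ENNReal.ofReal_le_ofReal (Real.exp_le_exp.2 (hBD x hx))
  have hwB : ENNReal.ofReal (Real.exp (-N * (β * E + |β| * ε))) *
      (Measure.pi fun _ : Fin (n + 1) => μ₀) B ≤ realWeight μ₀ w β (n + 1) B := by
    have hHm := measurable_realHamiltonian hw (n + 1)
    rw [realWeight, withDensity_apply _ hBm, ← setLIntegral_const]
    exact setLIntegral_mono (by fun_prop) fun x hx =>
      ENNReal.ofReal_le_ofReal (Real.exp_le_exp.2 (hBE x hx))
  refine le_trans ?_ (measure_mono hBG)
  refine le_trans ?_ hwB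
  calc ENNReal.ofReal (1 / 2 * Real.exp (-a * N))
      ≤ ENNReal.ofReal (Real.exp (-N * (β * E + |β| * ε)) *
          Real.exp (-(N * (D + 2 * ε)))) * (1 / 2) := by
        rw [mul_comm, ENNReal.ofReal_mul (Real.exp_pos _).le,
          show ENNReal.ofReal (1 / 2) = 1 / 2 by
            rw [ENNReal.ofReal_div_of_pos (by norm_num)]; simp]
        refine mul_le_mul_left (ENNReal.ofReal_le_ofReal ?_) _
        rw [← Real.exp_add]
        refine Real.exp_le_exp.2 ?_
        have := mul_le_mul_of_nonneg_left hεa hN.le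
        linarith
    _ ≤ ENNReal.ofReal (Real.exp (-N * (β * E + |β| * ε)) *
          Real.exp (-(N * (D + 2 * ε)))) * (ENNReal.ofReal (Real.exp (N * (D + 2 * ε))) *
            (Measure.pi fun _ : Fin (n + 1) => μ₀) B) := by
        gcongr
        exact hPB.trans hPle
    _ = _ := by
        rw [← mul_assoc, ← ENNReal.ofReal_mul (by positivity), mul_assoc, ← Real.exp_add]
        simp

end RealInteraction

end MeanField

/-! ### Total mass and finiteness of the infimum -/

namespace MeanField

open InformationTheory

namespace RealInteraction

variable {X : Type*} [MetricSpace X] [CompactSpace X] [MeasurableSpace X] [BorelSpace X]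
  {μ₀ : Measure X} [IsProbabilityMeasure μ₀] {w : X × X → ℝ} {Φ : ℕ → C(X × X, ℝ)}
  {b₀ c : ℝ} {C : ℝ≥0∞}

lemma exists_realWeight_univ_le (h : RealInteraction μ₀ w Φ b₀ c C) {β : ℝ} (hβ : -b₀ ≤ β) :
    ∃ a : ℝ, ∀ n : ℕ, realWeight μ₀ w β (n + 1) Set.univ ≤
      ENNReal.ofReal (1 * Real.exp (-a * ((n : ℝ) + 1))) := by
  have hw := h.measurable
  set S : ℝ≥0∞ := ENNReal.ofReal (Real.exp (-β * c)) *
    (ENNReal.ofReal (Real.exp (-(b₀ * c))) * C)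
  have hStop : S ≠ ⊤ := ENNReal.mul_ne_top ENNReal.ofReal_ne_top
    (ENNReal.mul_ne_top ENNReal.ofReal_ne_top h.ne_top)
  set s : ℝ := max S.toReal 1
  have hs1 : 1 ≤ s := le_max_right _ _
  have hSs : S ≤ ENNReal.ofReal s := by
    rw [← ENNReal.ofReal_toReal hStop]
    exact ENNReal.ofReal_le_ofReal (le_max_left _ _)
  refine ⟨-Real.log s, fun n => ?_⟩
  have h1 := MeanField.lintegral_exp_realHamiltonian_le μ₀ (V := fun p => -β * w p) (by fun_prop)
    (φ := fun _ => 0) measurable_const (A := 0) (fun _ => le_rfl) (S := S) (fun x => by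
      refine le_trans ?_ (mul_le_mul_right (h.lintegral_exp_le (b := -β) (by linarith) x) _)
      rw [← lintegral_const_mul _ (by fun_prop)]
      refine lintegral_mono fun y => ?_
      rw [← ENNReal.ofReal_mul (Real.exp_pos _).le, ← Real.exp_add]
      exact ENNReal.ofReal_le_ofReal (Real.exp_le_exp.2 (by linarith))) n
  simp only [realHamiltonian_const_mul, Finset.sum_const_zero, add_zero, Real.exp_zero,
    ENNReal.ofReal_one, one_mul] at h1
  rw [realWeight, withDensity_apply _ MeasurableSet.univ, setLIntegral_univ]
  refine h1.trans ((pow_le_pow_left' hSs n).trans ?_)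
  rw [← ENNReal.ofReal_pow (by positivity), neg_neg, one_mul, Real.exp_mul,
    Real.exp_log (by positivity)]
  refine ENNReal.ofReal_le_ofReal ?_
  rw [← Real.rpow_natCast]
  exact Real.rpow_le_rpow_of_exponent_le hs1 (by linarith)

set_option linter.unusedSectionVars false in
lemma realWeight_univ_ne_zero (h : RealInteraction μ₀ w Φ b₀ c C) (β : ℝ) (N : ℕ) :
    realWeight μ₀ w β N Set.univ ≠ 0 := by
  have hw := h.measurable
  have hHm := measurable_realHamiltonian hw N
  rw [realWeight, withDensity_apply _ MeasurableSet.univ, setLIntegral_univ]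
  intro h0
  rw [lintegral_eq_zero_iff (by fun_prop)] at h0
  obtain ⟨x, hx⟩ := h0.exists
  exact absurd hx (by simp [Real.exp_pos])

/-- The total mass grows at most exponentially, so by the local lower bound no measure has rate
below that growth; `μ₀` itself has finite free energy. -/
lemma exists_iInf_eq (h : RealInteraction μ₀ w Φ b₀ c C) {β : ℝ} (hβ : -b₀ < β) :
    ∃ m : ℝ, ⨅ μ, realFreeEnergy μ₀ w β μ = (m : EReal) := by
  obtain ⟨a, ha⟩ := h.exists_realWeight_univ_le hβ.le
  have hlow : ((a : ℝ) : EReal) ≤ ⨅ μ, realFreeEnergy μ₀ w β μ := by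
    by_contra! hlt
    obtain ⟨a', h1, h2⟩ := EReal.lt_iff_exists_real_btwn.1 hlt
    obtain ⟨μ, hμ⟩ := iInf_lt_iff.1 h1
    obtain ⟨k, hk, hb⟩ := h.localLowerBound β μ a' hμ Set.univ isOpen_univ trivial
    have h3 := ((le_liminf_log_div hk hb).trans liminf_le_limsup).trans
      (limsup_log_div_le one_pos (a := a) (Eventually.of_forall fun n => by
        rw [empiricalLaw_apply _ (@MeasurableSet.univ _ (borel _))]
        exact ha n))
    rw [EReal.neg_le_neg_iff] at h3
    exact absurd h2 (not_lt.2 h3)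
  have hup : ⨅ μ, realFreeEnergy μ₀ w β μ ≠ ⊤ := by
    obtain ⟨ν, hν⟩ : ∃ ν : ProbabilityMeasure X, (ν : Measure X) = μ₀ :=
      ⟨⟨μ₀, inferInstance⟩, rfl⟩
    have hfin : realFreeEnergy μ₀ w β ν ≠ ⊤ := by
      have : klDiv (ν : Measure X) μ₀ ≠ ⊤ := by simp [hν]
      rw [realFreeEnergy, if_neg this]
      exact EReal.coe_ne_top _
    exact ne_top_of_le_ne_top hfin (iInf_le _ _)
  exact ⟨_, (EReal.coe_toReal hup ((EReal.bot_lt_coe a).trans_le hlow).ne').symm⟩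

end RealInteraction

/-! ### Reduction to real-valued interactions -/

section Reduction

variable {X : Type*} [MetricSpace X] [CompactSpace X] [MeasurableSpace X] [BorelSpace X]
  {μ₀ : Measure X} [IsProbabilityMeasure μ₀] {W : X × X → EReal}

set_option linter.unusedSectionVars false in
-- The exponential is infinite where `W` is. Validity for every `x` lets the statement pass to `μ ⊗
-- μ` for any `μ` absolutely continuous with respect to `μ₀`.
lemma ae_ne_top (hW : LowerSemicontinuous W) {β₀ : ℝ} (hβ₀ : β₀ < 0)
    (hexp : (⨆ x, ∫⁻ y, EReal.exp (((-β₀ : ℝ) : EReal) * W (x, y)) ∂μ₀) < ⊤) (x : X) :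
    ∀ᵐ y ∂μ₀, W (x, y) ≠ ⊤ := by
  have hm := hW.measurable
  have h1 : ∫⁻ y, EReal.exp (((-β₀ : ℝ) : EReal) * W (x, y)) ∂μ₀ ≠ ⊤ :=
    ((le_iSup (fun x => ∫⁻ y, EReal.exp (((-β₀ : ℝ) : EReal) * W (x, y)) ∂μ₀) x).trans_lt hexp).ne
  have hm2 : Measurable fun y => EReal.exp (((-β₀ : ℝ) : EReal) * W (x, y)) := by
    fun_prop
  filter_upwards [ae_lt_top hm2 h1] with y hy htop
  rw [htop, EReal.coe_mul_top_of_pos (by linarith)] at hy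
  simp at hy

/-- The real-valued part of a singular interaction with exponential moments. -/
theorem exists_realInteraction (hbot : ∀ p, W p ≠ ⊥) (hW : LowerSemicontinuous W) {β₀ : ℝ}
    (hβ₀ : β₀ < 0) (hexp : (⨆ x, ∫⁻ y, EReal.exp (((-β₀ : ℝ) : EReal) * W (x, y)) ∂μ₀) < ⊤) :
    ∃ Φ c C, RealInteraction μ₀ (fun p => (W p).toReal) Φ (-β₀) c C := by
  obtain ⟨c, hc0, hc⟩ := exists_real_le_of_lowerSemicontinuous hW hbot
  obtain ⟨Φ, h1, h2, h3⟩ := exists_continuous_tendsto_of_lowerSemicontinuous hW hc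
  rw [min_eq_left hc0] at h1
  have hm := hW.measurable
  have hae := ae_ne_top hW hβ₀ hexp
  have hcoe : ∀ p, W p ≠ ⊤ → (((W p).toReal : ℝ) : EReal) = W p := fun p hp =>
    EReal.coe_toReal hp (hbot p)
  refine ⟨Φ, c, _, ⟨hm.ereal_toReal, fun p => ?_, h1, fun x => ?_, fun x => ?_, by linarith,
    fun x => ?_, hexp.ne⟩⟩
  -- At infinite values the default is `toReal ⊤ = 0`, which respects the lower bound because `c ≤
  -- 0`.
  · by_cases hp : W p = ⊤
    · simp [hp, hc0]
    · rw [← EReal.coe_le_coe_iff, hcoe p hp]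
      exact hc p
  · filter_upwards [hae x] with y hy k
    rw [← EReal.coe_le_coe_iff, hcoe _ hy]
    exact h2 k _
  · filter_upwards [hae x] with y hy
    rw [← EReal.tendsto_coe, hcoe _ hy]
    exact h3 _
  · refine le_trans (le_of_eq (lintegral_congr_ae ?_))
      (le_iSup (fun x => ∫⁻ y, EReal.exp (((-β₀ : ℝ) : EReal) * W (x, y)) ∂μ₀) x)
    filter_upwards [hae x] with y hy
    rw [← hcoe _ hy, ← EReal.coe_mul, EReal.exp_coe, EReal.toReal_coe]

lemma hamiltonian_eq_coe {X : Type*} {W : X × X → EReal} (hbot : ∀ p, W p ≠ ⊥) {N : ℕ}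
    {x : Fin N → X} (hx : ∀ i j, i ≠ j → W (x i, x j) ≠ ⊤) :
    hamiltonian W N x = (realHamiltonian (fun p => (W p).toReal) N x : EReal) := by
  rw [hamiltonian, realHamiltonian, EReal.coe_mul]
  congr 1
  have hsum : ∀ s : Finset (Fin N × Fin N), (∀ p ∈ s, p.1 ≠ p.2) →
      ∑ p ∈ s, W (x p.1, x p.2) = ((∑ p ∈ s, (W (x p.1, x p.2)).toReal : ℝ) : EReal) := by
    intro s
    induction s using Finset.cons_induction with
    | empty => simp
    | cons p s hp ih =>
      intro hs
      rw [Finset.sum_cons, Finset.sum_cons, EReal.coe_add,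
        ih fun q hq => hs q (Finset.mem_cons_of_mem hq),
        EReal.coe_toReal (hx _ _ (hs p (Finset.mem_cons_self _ _))) (hbot _)]
  exact hsum _ fun p hp => (Finset.mem_filter.1 hp).2

lemma ae_exp_hamiltonian (hbot : ∀ p, W p ≠ ⊥) (hW : LowerSemicontinuous W)
    (hae : ∀ x, ∀ᵐ y ∂μ₀, W (x, y) ≠ ⊤) (β : ℝ) (N : ℕ) :
    (fun x => EReal.exp (((-β : ℝ) : EReal) * hamiltonian W N x))
      =ᵐ[Measure.pi fun _ => μ₀]
    fun x => ENNReal.ofReal (Real.exp (-β * realHamiltonian (fun p => (W p).toReal) N x)) := by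
  have hm := hW.measurable
  have hpr : ∀ᵐ p ∂(μ₀.prod μ₀), W p ≠ ⊤ := by
    refine (Measure.ae_prod_iff_ae_ae ?_).2 (ae_of_all _ hae)
    exact (hm (measurableSet_singleton ⊤)).compl
  have hall : ∀ᵐ x ∂(Measure.pi fun _ : Fin N => μ₀), ∀ i j, i ≠ j → W (x i, x j) ≠ ⊤ := by
    refine ae_all_iff.2 fun i => ae_all_iff.2 fun j => ?_
    by_cases hij : i = j
    · exact ae_of_all _ fun _ h => absurd hij h
    · filter_upwards [(measurePreserving_eval_pair μ₀ hij).quasiMeasurePreserving.ae hpr] with x hx _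
      exact hx
  filter_upwards [hall] with x hx
  rw [hamiltonian_eq_coe hbot hx, ← EReal.coe_mul, EReal.exp_coe]

lemma freeEnergy_eq (hbot : ∀ p, W p ≠ ⊥) (hW : LowerSemicontinuous W)
    (hae : ∀ x, ∀ᵐ y ∂μ₀, W (x, y) ≠ ⊤) {Φ : ℕ → C(X × X, ℝ)} {b₀ c : ℝ} {C : ℝ≥0∞}
    (h : RealInteraction μ₀ (fun p => (W p).toReal) Φ b₀ c C) (β : ℝ) :
    freeEnergy μ₀ W β = realFreeEnergy μ₀ (fun p => (W p).toReal) β := by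
  funext μ
  rw [freeEnergy, realFreeEnergy]
  split_ifs with hD
  · rfl
  have hμ := (klDiv_ne_top_iff.1 hD).1
  have hm := hW.measurable
  have hpr : ∀ᵐ p ∂((μ : Measure X).prod (μ : Measure X)), W p ≠ ⊤ := by
    refine (Measure.ae_prod_iff_ae_ae ?_).2 (ae_of_all _ fun x => hμ.ae_le (hae x))
    exact (hm (measurableSet_singleton ⊤)).compl
  have hint := h.integrable hD
  have hE : energy W μ =
      ((∫ p, (W p).toReal ∂((μ : Measure X).prod (μ : Measure X)) : ℝ) : EReal) := by
    have hp : ∫⁻ p, (W p).toENNReal ∂((μ : Measure X).prod (μ : Measure X)) =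
        ∫⁻ p, ENNReal.ofReal (W p).toReal ∂((μ : Measure X).prod (μ : Measure X)) := by
      refine lintegral_congr_ae ?_
      filter_upwards [hpr] with p hp
      rw [EReal.toENNReal_of_ne_top hp]
    have hn : ∫⁻ p, (-W p).toENNReal ∂((μ : Measure X).prod (μ : Measure X)) =
        ∫⁻ p, ENNReal.ofReal (-(W p).toReal) ∂((μ : Measure X).prod (μ : Measure X)) := by
      refine lintegral_congr fun p => ?_
      rw [EReal.toENNReal_of_ne_top (by simpa using hbot p), EReal.toReal_neg_eq]
    rw [energy, eintegral, hp, hn, integral_eq_lintegral_pos_part_sub_lintegral_neg_part hint,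
      EReal.coe_sub, EReal.coe_ennreal_toReal, EReal.coe_ennreal_toReal]
    · exact hint.neg.lintegral_lt_top.ne
    · exact hint.lintegral_lt_top.ne
  rw [hE, ← EReal.coe_mul, EReal.coe_add, EReal.coe_ennreal_toReal hD]

/-- The large deviation principle for mean field Gibbs measures of a singular interaction with
uniform exponential moments. -/
theorem gibbsLDP_of_exp_moment (hbot : ∀ p, W p ≠ ⊥) (hW : LowerSemicontinuous W) {β₀ : ℝ}
    (hβ₀ : β₀ < 0) (hexp : (⨆ x, ∫⁻ y, EReal.exp (((-β₀ : ℝ) : EReal) * W (x, y)) ∂μ₀) < ⊤)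
    {β : ℝ} (hβ : β₀ < β) : GibbsLDP μ₀ W β := by
  obtain ⟨Φ, c, C, h⟩ := exists_realInteraction hbot hW hβ₀ hexp
  have hae := ae_ne_top hW hβ₀ hexp
  have hweight : ∀ N, gibbsWeight μ₀ W β N = realWeight μ₀ (fun p => (W p).toReal) β N := fun N =>
    withDensity_congr_ae (ae_exp_hamiltonian hbot hW hae β N)
  have hpart : ∀ N, partition μ₀ W β N =
      realWeight μ₀ (fun p => (W p).toReal) β N Set.univ := fun N => by
    rw [← hweight, gibbsWeight, withDensity_apply _ MeasurableSet.univ, setLIntegral_univ,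
      partition]
  have hβ' : -(-β₀) < β := by linarith
  have hup := h.localUpperBound hβ'
  have hlow := h.localLowerBound β
  have hF := freeEnergy_eq hbot hW hae h β
  have hFbot : ∀ μ, realFreeEnergy μ₀ (fun p => (W p).toReal) β μ ≠ ⊥ := fun μ => by
    rw [realFreeEnergy]
    split_ifs
    · exact top_ne_bot
    · exact EReal.coe_ne_bot _
  refine ⟨fun n => ?_, fun n => ?_, ?_, ?_⟩
  · rw [hpart]; exact h.realWeight_univ_ne_zero β _
  · obtain ⟨a, ha⟩ := h.exists_realWeight_univ_le hβ'.le
    rw [hpart]; exact ne_top_of_le_ne_top ENNReal.ofReal_ne_top (ha n)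
  · simp_rw [hweight, hF]
    exact LDP.of_localBounds hFbot hup hlow
  · obtain ⟨m, hm⟩ := h.exists_iInf_eq hβ'
    refine ⟨m, by rw [hF]; exact hm, ?_⟩
    have key := LDP.of_localBounds_normalized hFbot hup hlow hm
    rw [hF]
    convert! key using 2 with n
    rw [gibbs, hpart, hweight, empiricalLaw_apply _ (@MeasurableSet.univ _ (borel _)),
      Set.preimage_univ]
    exact Measure.map_smul _ _ _

end Reduction

/-! ### The planar vortex model -/

section Logarithmic

lemma continuous_logInteraction {X : Type*} [MetricSpace X] :
    Continuous (logInteraction : X × X → EReal) :=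
  (ENNReal.continuous_log.comp continuous_edist).neg

lemma exp_mul_logInteraction {X : Type*} [MetricSpace X] (b : ℝ) (p : X × X) :
    EReal.exp ((b : EReal) * logInteraction p) = (edist p.1 p.2)⁻¹ ^ b := by
  rw [mul_comm, EReal.exp_mul, logInteraction, EReal.exp_neg, ENNReal.exp_log]

/-- Inside the unit ball around `x`, translation invariance reduces to integrability of `|z|^{-b}`
at the origin, which needs `b < 2`; outside, the integrand is at most `1`. -/
lemma lintegral_inv_edist_rpow_le {b : ℝ} (hb0 : 0 < b) (hb : b < 2) :
    ∃ C : ℝ≥0∞, C ≠ ⊤ ∧ ∀ (K : Set (EuclideanSpace ℝ (Fin 2))) (x : EuclideanSpace ℝ (Fin 2)),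
      ∫⁻ y in K, (edist x y)⁻¹ ^ b ≤ C + volume K := by
  set g : EuclideanSpace ℝ (Fin 2) → ℝ := fun z => ‖z‖ ^ (-b)
  have hgm : Measurable g := by simp only [g]; fun_prop
  have hint : IntegrableOn g (Metric.ball 0 1) volume := by
    refine integrableOn_ball_of_norm_le_rpow (C := 1) (α := b) (by simp) (by simpa using hb)
      (ae_of_all _ fun x => ?_) hgm.aestronglyMeasurable
    rw [one_mul, Real.norm_of_nonneg (by positivity)]
  set G : EuclideanSpace ℝ (Fin 2) → ℝ≥0∞ :=
    (Metric.ball 0 1).indicator fun z => ENNReal.ofReal (g z)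
  have hGm : Measurable G := hgm.ennreal_ofReal.indicator Metric.isOpen_ball.measurableSet
  refine ⟨∫⁻ z, G z, ?_, fun K x => ?_⟩
  · rw [lintegral_indicator Metric.isOpen_ball.measurableSet]
    exact hint.lintegral_lt_top.ne
  · have hpt : ∀ᵐ y ∂volume.restrict K, (edist x y)⁻¹ ^ b ≤ G (y - x) + 1 := by
      have hne : ∀ᵐ y ∂volume.restrict K, y ≠ x :=
        ae_restrict_of_ae (by simp [ae_iff])
      filter_upwards [hne] with y hy
      have hpos : 0 < ‖y - x‖ := norm_pos_iff.2 (sub_ne_zero.2 hy)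
      have he : (edist x y)⁻¹ ^ b = ENNReal.ofReal (‖y - x‖ ^ (-b)) := by
        rw [edist_comm, edist_dist, dist_eq_norm, ← ENNReal.ofReal_inv_of_pos hpos,
          ENNReal.ofReal_rpow_of_pos (inv_pos.2 hpos), Real.rpow_neg hpos.le,
          Real.inv_rpow hpos.le]
      rw [he]
      by_cases hball : y - x ∈ Metric.ball (0 : EuclideanSpace ℝ (Fin 2)) 1
      · simp only [G, Set.indicator_of_mem hball]
        exact le_self_add
      · refine le_trans ?_ le_add_self
        rw [mem_ball_zero_iff, not_lt] at hball
        rw [← ENNReal.ofReal_one]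
        exact ENNReal.ofReal_le_ofReal (Real.rpow_le_one_of_one_le_of_nonpos hball (by linarith))
    calc _ ≤ ∫⁻ y in K, (G (y - x) + 1) := lintegral_mono_ae hpt
      _ = (∫⁻ y in K, G (y - x)) + volume K := by
          rw [lintegral_add_right _ measurable_const]; simp
      _ ≤ (∫⁻ y, G (y - x)) + volume K := by
          gcongr; exact Measure.restrict_le_self
      _ = _ := by rw [lintegral_sub_right_eq_self]

/-- The large deviation principle for the vortex model on a compact planar set. -/
theorem gibbsLDP_logInteraction {K : Set (EuclideanSpace ℝ (Fin 2))} (hK : IsCompact K)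
    (hvol : volume K ≠ 0) {β : ℝ} (hβ : -2 < β) :
    GibbsLDP ((volume K)⁻¹ •
      Measure.comap (Subtype.val : K → EuclideanSpace ℝ (Fin 2)) volume) logInteraction β := by
  have hKm := hK.measurableSet
  have hfin : volume K ≠ ⊤ := hK.measure_lt_top.ne
  have : CompactSpace K := isCompact_iff_compactSpace.1 hK
  have : IsProbabilityMeasure ((volume K)⁻¹ •
      Measure.comap (Subtype.val : K → EuclideanSpace ℝ (Fin 2)) volume) := by
    refine ⟨?_⟩
    rw [Measure.smul_apply, comap_subtype_coe_apply hKm, Set.image_univ, Subtype.range_coe,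
      smul_eq_mul, ENNReal.inv_mul_cancel hvol hfin]
  have hmin : -2 < min β 0 := lt_min hβ (by norm_num)
  -- The midpoint lies strictly between `-2` and both `β` and `0`.
  set β₀ : ℝ := (-2 + min β 0) / 2
  have hβ₀ : β₀ < min β 0 := by simp only [β₀]; linarith
  have hβ₀2 : -2 < β₀ := by simp only [β₀]; linarith
  have hβ₀neg : β₀ < 0 := hβ₀.trans_le (min_le_right _ _)
  refine gibbsLDP_of_exp_moment (fun p => ?_) continuous_logInteraction.lowerSemicontinuous
    hβ₀neg ?_ (hβ₀.trans_le (min_le_left _ _))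
  · simp [logInteraction, edist_ne_top]
  · obtain ⟨C, hC, hbound⟩ := lintegral_inv_edist_rpow_le (b := -β₀) (by linarith) (by linarith)
    refine lt_of_le_of_lt (iSup_le fun x => ?_)
      (ENNReal.mul_lt_top (ENNReal.inv_lt_top.2 (pos_iff_ne_zero.2 hvol))
        (ENNReal.add_lt_top.2 ⟨hC.lt_top, hfin.lt_top⟩))
    simp_rw [exp_mul_logInteraction]
    rw [lintegral_smul_measure, smul_eq_mul]
    refine mul_le_mul_right ?_ _
    exact (lintegral_subtype_comap hKm fun y => (edist (x : EuclideanSpace ℝ (Fin 2)) y)⁻¹ ^ (-β₀)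
      ).trans_le (hbound K x)

end Logarithmic

end MeanField

theorem theorem1p5 :
    (∀ (X : Type*) [MetricSpace X] [CompactSpace X] [MeasurableSpace X] [BorelSpace X]
      (μ₀ : Measure X) [IsProbabilityMeasure μ₀]
      (W : X × X → EReal),
      (∀ p, W p ≠ ⊥) → LowerSemicontinuous W → (∀ x y, W (x, y) = W (y, x)) →
      ∀ β₀ : ℝ, β₀ < 0 →
      (⨆ x, ∫⁻ y, EReal.exp (((-β₀ : ℝ) : EReal) * W (x, y)) ∂μ₀) < ⊤ →
      ∀ β : ℝ, β₀ < β → MeanField.GibbsLDP μ₀ W β) ∧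
    (∀ K : Set (EuclideanSpace ℝ (Fin 2)), IsCompact K → volume K ≠ 0 →
      ∀ β : ℝ, -2 < β →
        MeanField.GibbsLDP ((volume K)⁻¹ • Measure.comap (Subtype.val : K → EuclideanSpace ℝ (Fin 2)) volume)
          MeanField.logInteraction β) :=
  ⟨fun _ _ _ _ _ _ _ _ hbot hW _ _ hβ₀ hexp _ hβ =>
      MeanField.gibbsLDP_of_exp_moment hbot hW hβ₀ hexp hβ,
    fun _ hK hvol _ hβ => MeanField.gibbsLDP_logInteraction hK hvol hβ⟩
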